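/- For $k\ge 1$ let $\mathcal M_k\subset\mathbb R^k$ be the set of all vectors $(c_1,\dots,c_k)$ with $c_i=\int_0^1 x^i\,\eta(dx)$, $i=1,\dots,k$, where $\eta$ is a probability measure on $[0,1]$. On a probability space let, for each $n\ge 1$, $(C_{1,2n-1},\dots,C_{2n-1,2n-1})$ be a random vector that is uniformly distributed on $\mathcal M_{2n-1}$ (nothing is assumed about the joint law for different $n$). Put $c_0=1$, $c_i=C_{i,2n-1}$, and let $$P_{n,n}(x)=\left|\begin{array}{cccc} c_0&\cdots&c_{n-1}&1\\ \vdots&&\vdots&\vdots\\ c_n&\cdots&c_{2n-1}&x^n\end{array}\right|\Big/\left|\begin{array}{ccc} c_0&\cdots&c_{n-1}\\ \vdots&&\vdots\\ c_{n-1}&\cdots&c_{2n-2}\end{array}\right|$$ be the associated $n$-th monic orthogonal polynomial. Then, almost surely, for every $n\ge1$ the polynomial $P_{n,n}$ is well defined and has $n$ real roots $X_{1,n},\dots,X_{n,n}$ (counted with multiplicity), and their empirical distribution functions $F_n(x)=\frac1n\sum_{j=1}^n I\{X_{j,n}\le x\}$ satisfy $$\lim_{n\to\infty}F_n(x)=\frac1\pi\int_0^x\frac{dt}{\sqrt{t(1-t)}}\qquad\text{for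 all } x\in[0,1].$$ -/

import Mathlib

open MeasureTheory

open scoped Polynomial

noncomputable section

/-- The `k`-th moment space of `[0,1]`: the vectors `(c₁, …, c_k)` of moments of the probability
measures on `[0,1]`. The coordinate with index `i : Fin k` is the moment of order `i + 1`. -/
def momentSpace (k : ℕ) : Set (Fin k → ℝ) :=
  {c | ∃ μ : Measure (Set.Icc (0 : ℝ) 1), IsProbabilityMeasure μ ∧
    ∀ i : Fin k, c i = ∫ x, (x : ℝ) ^ ((i : ℕ) + 1) ∂μ}

/-- The sequence `c₀ = 1, c₁, …, c_k` attached to a vector `(c₁, …, c_k)`, continued by `0`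
(the continuation plays no role below). -/
def momentSeq {k : ℕ} (c : Fin k → ℝ) : ℕ → ℝ
  | 0 => 1
  | j + 1 => if h : j < k then c ⟨j, h⟩ else 0

/-- The numerator: the determinant of the `(m+1) × (m+1)` matrix with rows
`(c_i, …, c_{i+m-1}, x^i)`, `i = 0, …, m`, as a polynomial in `x`. -/
def borderedHankelDet (s : ℕ → ℝ) (m : ℕ) : ℝ[X] :=
  Matrix.det (Matrix.of fun i j : Fin (m + 1) =>
    if (j : ℕ) < m then Polynomial.C (s ((i : ℕ) + (j : ℕ))) else Polynomial.X ^ (i : ℕ))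

/-- The denominator: the determinant of the `m × m` Hankel matrix `(c_{i+j})`,
`i, j = 0, …, m - 1`. -/
def hankelDet (s : ℕ → ℝ) (m : ℕ) : ℝ :=
  Matrix.det (Matrix.of fun i j : Fin m => s ((i : ℕ) + (j : ℕ)))

/-- The `m`-th monic orthogonal polynomial of the moment sequence `s`, as a quotient of two
determinants (it is monic of degree `m` as soon as the denominator is not zero). -/
def monicOrthogonalPoly (s : ℕ → ℝ) (m : ℕ) : ℝ[X] :=
  Polynomial.C (hankelDet s m)⁻¹ * borderedHankelDet s m

/-- The empirical distribution function `x ↦ (1/n) #{j : x_j ≤ x}` of the real roots `x_j`, counted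
with multiplicity, of a real polynomial of degree `n`. -/
def rootEDF (n : ℕ) (p : ℝ[X]) (x : ℝ) : ℝ :=
  (1 / (n : ℝ)) * ((p.roots.countP fun y => y ≤ x : ℕ) : ℝ)

end

/-! Gauss quadrature shows that a point of the moment space of order `2 * n - 1` is the moment
vector of a measure with `n` atoms in [0,1]. When the atoms are distinct and the weights nonzero,
the atoms are exactly the roots of the orthogonal polynomial (`momentSpace_eq_image`,
`roots_monicOrthogonalPoly`). In the coordinates (weights, nodes), the Jacobian is the product of
the weights times the fourth power of the Vandermonde determinant of the nodes
(`abs_det_momentJacobian`), so the roots behave like a log-gas confined to [0,1].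

The arcsine law is the equilibrium measure of this gas, and only a large deviation upper bound is
needed. The moment space contains simplices spanned by points of the moment curve, and Leja points
give volume at least 16^(-n^2) up to a factor n^(-O(n)) (`volume_momentSpace_ge_pow`). Writing x =
(1 + cos θ) / 2 and expanding the logarithmic energy in a Fourier series bounds the Jacobian by
16^(-n^2) exp(-c n^2), up to a correction that can be made small compared with exp(c n^2), whenever
some Chebyshev moment of the roots is at least δ (`sepProd_sq_le`).

The ratio of the two volumes is summable, so Borel–Cantelli, which needs no assumption on the joint
law, sends every Chebyshev moment to 0 almost surely. Weierstrass approximation and ramp functions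
turn this into convergence of the distribution functions. -/

noncomputable section

/-! ### Vandermonde and confluent Vandermonde determinants. -/

/-- The product of the distances of all ordered pairs of distinct indices. -/
def sepProd {ι : Type*} [Fintype ι] [DecidableEq ι] (x : ι → ℝ) : ℝ :=
  ∏ i, ∏ j, if i = j then 1 else |x i - x j|

theorem sepProd_nonneg {ι : Type*} [Fintype ι] [DecidableEq ι] (x : ι → ℝ) : 0 ≤ sepProd x :=
  Finset.prod_nonneg fun i _ => Finset.prod_nonneg fun j _ => by split_ifs <;> positivity

theorem continuous_sepProd {ι : Type*} [Fintype ι] [DecidableEq ι] :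
    Continuous (sepProd : (ι → ℝ) → ℝ) := by
  unfold sepProd
  refine continuous_finsetProd _ fun i _ => continuous_finsetProd _ fun j _ => ?_
  split_ifs
  · exact continuous_const
  · fun_prop

theorem sepProd_eq_zero {ι : Type*} [Fintype ι] [DecidableEq ι] {x : ι → ℝ}
    (hx : ¬ Function.Injective x) : sepProd x = 0 := by
  simp only [Function.Injective, not_forall] at hx
  obtain ⟨i, j, h, hij⟩ := hx
  refine Finset.prod_eq_zero (Finset.mem_univ i) (Finset.prod_eq_zero (Finset.mem_univ j) ?_)
  simp [hij, h]

theorem sepProd_comp_equiv {ι κ : Type*} [Fintype ι] [DecidableEq ι] [Fintype κ] [DecidableEq κ]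
    (e : κ ≃ ι) (x : ι → ℝ) : sepProd (x ∘ e) = sepProd x := by
  unfold sepProd
  rw [← e.prod_comp]
  refine Finset.prod_congr rfl fun i _ => ?_
  rw [← e.prod_comp]
  simp

theorem det_vandermonde_sq {N : ℕ} (v : Fin N → ℝ) :
    (Matrix.vandermonde v).det ^ 2 = sepProd v := by
  have h1 := Finset.prod_prod_Ioi_mul_eq_prod_prod_off_diag (fun i j => |v i - v j|)
  have h2 : sepProd v = ∏ i, ∏ j ∈ ({i}ᶜ : Finset (Fin N)), |v j - v i| := by
    unfold sepProd
    refine Finset.prod_congr rfl fun i _ => ?_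
    rw [← Finset.prod_mul_prod_compl ({i} : Finset (Fin N))]
    simp only [Finset.prod_singleton, if_true, one_mul]
    refine Finset.prod_congr rfl fun j hj => ?_
    rw [if_neg (fun h => by simp [h] at hj), abs_sub_comm]
  rw [h2, ← h1, Matrix.det_vandermonde, ← Finset.prod_pow]
  refine Finset.prod_congr rfl fun i _ => ?_
  rw [← Finset.prod_pow]
  refine Finset.prod_congr rfl fun j _ => ?_
  rw [abs_sub_comm (v i), abs_mul_abs_self, sq]

theorem det_powers_sq {ι : Type*} [Fintype ι] [DecidableEq ι] {N : ℕ} (e : ι ≃ Fin N)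
    (v : ι → ℝ) :
    (Matrix.of fun k j : ι => v j ^ (e k : ℕ)).det ^ 2 = sepProd v := by
  have h : (Matrix.of fun k j : ι => v j ^ (e k : ℕ))
      = ((Matrix.vandermonde (v ∘ e.symm)).transpose).submatrix e e := by
    ext k j
    simp [Matrix.vandermonde_apply]
  rw [h, Matrix.det_submatrix_equiv_self, Matrix.det_transpose, det_vandermonde_sq,
    sepProd_comp_equiv]

/-- Doubling each node with a copy at distance `h` isolates the power of `h` by which the
Vandermonde determinant degenerates; difference quotients cancel exactly this power. -/
theorem sepProd_sum_shift {ι : Type*} [Fintype ι] [DecidableEq ι] (x : ι → ℝ) (h : ℝ) :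
    sepProd (Sum.elim x fun i => x i + h)
      = (sepProd x * (|h| ^ Fintype.card ι *
          ∏ i, ∏ j, if i = j then 1 else |x i - x j - h|)) ^ 2 := by
  have h1 : ∀ i j : ι, |x i - (x j + h)|
      = (if i = j then |h| else 1) * (if i = j then 1 else |x i - x j - h|) := by
    intro i j
    split_ifs with hij
    · simp [hij]
    · rw [one_mul, sub_sub]
  have h2 : ∏ i, ∏ j, |x i - (x j + h)| = |h| ^ Fintype.card ι *
          ∏ i, ∏ j, if i = j then 1 else |x i - x j - h| := by
    simp_rw [h1, Finset.prod_mul_distrib]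
    simp [Finset.card_univ]
  have h3 : ∏ i, ∏ j, |x i + h - x j| = ∏ i, ∏ j, |x i - (x j + h)| := by
    rw [Finset.prod_comm]
    exact Finset.prod_congr rfl fun i _ => Finset.prod_congr rfl fun j _ => abs_sub_comm _ _
  rw [← h2]
  simp only [sepProd, Fintype.prod_sum_type, Sum.elim_inl, Sum.elim_inr, Sum.inl.injEq,
    Sum.inr.injEq, reduceCtorEq, if_false, add_sub_add_right_eq_sub, Finset.prod_mul_distrib, h3]
  ring

/-- The absolute value of the confluent Vandermonde determinant with all nodes doubled. -/
theorem abs_det_confluent {ι : Type*} [Fintype ι] [DecidableEq ι] {N : ℕ}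
    (e : ι ⊕ ι ≃ Fin N) (x : ι → ℝ) :
    |(Matrix.of fun (k : ι ⊕ ι) (j : ι ⊕ ι) =>
      Sum.elim (fun j => x j ^ (e k : ℕ)) (fun j => (e k : ℕ) * x j ^ ((e k : ℕ) - 1)) j).det|
      = sepProd x ^ 2 := by
  -- The derivative columns are limits of difference quotients. For `h ≠ 0` these are column
  -- combinations of an ordinary Vandermonde matrix.
  set K : ℝ → Matrix (ι ⊕ ι) (ι ⊕ ι) ℝ := fun h => Matrix.of fun k j =>
    Sum.elim (fun j => x j ^ (e k : ℕ))
      (fun j => h⁻¹ * ((x j + h) ^ (e k : ℕ) - x j ^ (e k : ℕ))) j with hK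
  set K0 := (Matrix.of fun (k : ι ⊕ ι) (j : ι ⊕ ι) =>
      Sum.elim (fun j => x j ^ (e k : ℕ)) (fun j => (e k : ℕ) * x j ^ ((e k : ℕ) - 1)) j) with hK0
  have hdet : ∀ h : ℝ, h ≠ 0 → (K h).det ^ 2
      = (sepProd x * ∏ i, ∏ j, if i = j then 1 else |x i - x j - h|) ^ 2 := by
    intro h hh
    set U : Matrix (ι ⊕ ι) (ι ⊕ ι) ℝ :=
      Matrix.fromBlocks 1 (-(h⁻¹ • (1 : Matrix ι ι ℝ))) 0 (h⁻¹ • (1 : Matrix ι ι ℝ)) with hU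
    set V : Matrix (ι ⊕ ι) (ι ⊕ ι) ℝ :=
      Matrix.of fun k j => (Sum.elim x fun i => x i + h) j ^ (e k : ℕ) with hV
    have hKV : K h = V * U := by
      ext k j
      rcases j with j | j
      · simp [hK, hV, hU, Matrix.mul_apply, Fintype.sum_sum_type, Matrix.one_apply]
      · simp [hK, hV, hU, Matrix.mul_apply, Fintype.sum_sum_type, Matrix.one_apply]
        ring
    have hUdet : U.det = (h⁻¹) ^ Fintype.card ι := by
      rw [hU, Matrix.det_fromBlocks_zero₂₁, Matrix.det_smul]
      simp
    rw [hKV, Matrix.det_mul, mul_pow, det_powers_sq, sepProd_sum_shift, hUdet]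
    have hc : (|h| ^ Fintype.card ι) ^ 2 * (h⁻¹ ^ Fintype.card ι) ^ 2 = 1 := by
      rw [← mul_pow, ← mul_pow, ← pow_mul, mul_comm _ 2, pow_mul, mul_pow, sq_abs, ← mul_pow,
        mul_inv_cancel₀ hh]
      simp
    linear_combination
      (sepProd x * ∏ i, ∏ j, if i = j then 1 else |x i - x j - h|) ^ 2 * hc
  have hlim1 : Filter.Tendsto (fun h => (K h).det ^ 2) (nhdsWithin 0 {0}ᶜ)
      (nhds (K0.det ^ 2)) := by
    refine Filter.Tendsto.pow ?_ 2
    have : Filter.Tendsto K (nhdsWithin 0 {0}ᶜ) (nhds K0) := by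
      refine tendsto_pi_nhds.2 fun k => tendsto_pi_nhds.2 fun j => ?_
      rcases j with j | j
      · exact tendsto_const_nhds
      · have := hasDerivAt_iff_tendsto_slope_zero.1 (hasDerivAt_pow (e k : ℕ) (x j))
        simpa [hK, hK0] using this
    exact (Continuous.matrix_det continuous_id).continuousAt.tendsto.comp this
  have hlim2 : Filter.Tendsto (fun h => (K h).det ^ 2) (nhdsWithin 0 {0}ᶜ)
      (nhds ((sepProd x * sepProd x) ^ 2)) := by
    have hc : Continuous fun h : ℝ =>
        (sepProd x * ∏ i, ∏ j, if i = j then 1 else |x i - x j - h|) ^ 2 := by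
      refine (continuous_const.mul (continuous_finsetProd _ fun i _ =>
        continuous_finsetProd _ fun j _ => ?_)).pow 2
      split_ifs
      · exact continuous_const
      · fun_prop
    have h0 := (hc.tendsto 0).mono_left (nhdsWithin_le_nhds (s := {0}ᶜ))
    simp only [sub_zero] at h0
    refine h0.congr' ?_
    filter_upwards [self_mem_nhdsWithin] with h hh
    exact (hdet h hh).symm
  have := tendsto_nhds_unique hlim1 hlim2
  rw [sq_eq_sq_iff_abs_eq_abs, abs_of_nonneg (mul_nonneg (sepProd_nonneg x) (sepProd_nonneg x))]
    at this
  rw [this, sq]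

/-- Eliminating one column from a matrix of moment type. -/
theorem det_eliminate {κ : Type*} [Fintype κ] [DecidableEq κ] (f : Unit ⊕ κ → ℝ) (a : κ → ℝ)
    (u : κ → κ → ℝ) (hf : f (Sum.inl ()) = 1) (M : Matrix (Unit ⊕ κ) (Unit ⊕ κ) ℝ)
    (h1 : ∀ k, M k (Sum.inl ()) = f k) (h2 : ∀ j, M (Sum.inl ()) (Sum.inr j) = a j)
    (h3 : ∀ k j, M (Sum.inr k) (Sum.inr j) = u k j) :
    M.det = (Matrix.of fun k j => u k j - f (Sum.inr k) * a j).det := by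
  have : M = Matrix.fromBlocks 1 (Matrix.of fun _ j => a j)
      (Matrix.of fun k _ => f (Sum.inr k)) (Matrix.of u) := by
    ext k j
    rcases k with k | k <;> rcases j with j | j <;> simp [h1, h2, h3, hf]
  rw [this, Matrix.det_fromBlocks_one₁₁]
  congr 1
  ext k j
  simp [Matrix.mul_apply]

/-! ### Lower bound for the volume of the moment space. -/

theorem sum_mul_pow_mem_momentSpace {ι : Type*} [Fintype ι] {N : ℕ} (x w : ι → ℝ)
    (hx : ∀ j, x j ∈ Set.Icc (0 : ℝ) 1) (hw : ∀ j, 0 ≤ w j) (hsum : ∑ j, w j = 1) :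
    (fun k : Fin N => ∑ j, w j * x j ^ ((k : ℕ) + 1)) ∈ momentSpace N := by
  refine ⟨∑ j, ENNReal.ofReal (w j) • Measure.dirac ⟨x j, hx j⟩, ⟨?_⟩, fun k => ?_⟩
  · simp only [Measure.coe_finsetSum, Finset.sum_apply, Measure.smul_apply, measure_univ,
      smul_eq_mul, mul_one]
    rw [← ENNReal.ofReal_sum_of_nonneg fun j _ => hw j, hsum, ENNReal.ofReal_one]
  · rw [integral_finsetSum_measure]
    · refine Finset.sum_congr rfl fun j _ => ?_
      rw [integral_smul_measure, integral_dirac, ENNReal.toReal_ofReal (hw j), smul_eq_mul]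
    · intro j _
      exact (integrable_dirac (by simp)).smul_measure ENNReal.ofReal_ne_top

/-- The simplex spanned by `N + 1` points of the moment curve. -/
theorem volume_momentSpace_ge {N : ℕ} (z : Fin (N + 1) → ℝ)
    (hz : ∀ j, z j ∈ Set.Icc (0 : ℝ) 1) :
    ENNReal.ofReal (√(sepProd z) * (1 / (N : ℝ)) ^ N) ≤ volume (momentSpace N) := by
  set A : Matrix (Fin N) (Fin N) ℝ :=
    Matrix.of fun k j => z j.succ ^ ((k : ℕ) + 1) - z 0 ^ ((k : ℕ) + 1) * 1 with hA
  -- Adding the row of zeroth powers turns the matrix of edge vectors into a full Vandermonde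
  -- matrix.
  have hdet : |A.det| = √(sepProd z) := by
    let r : Unit ⊕ Fin N → Fin (N + 1) := Sum.elim (fun _ => 0) Fin.succ
    have hr : Function.Bijective r := by
      refine (Fintype.bijective_iff_injective_and_card r).2 ⟨?_, by simp [add_comm]⟩
      rintro (a | a) (b | b) h <;> simp_all [r, Fin.succ_ne_zero, (Fin.succ_ne_zero _).symm]
    let e := Equiv.ofBijective r hr
    have h1 := det_powers_sq e (z ∘ e)
    rw [sepProd_comp_equiv, det_eliminate (fun k => z 0 ^ (e k : ℕ)) (fun _ => 1)
      (fun k j => z j.succ ^ ((k : ℕ) + 1))] at h1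
    · rw [← h1, Real.sqrt_sq_eq_abs]
      rfl
    · simp [e, r]
    · intro k; simp [e, r]
    · intro j; simp [e, r]
    · intro k j; simp [e, r]
  -- A cube inside the simplex of weights suffices: the loss is only of order exp(O(N log N)),
  -- negligible against exp(-c N^2).
  set B : Set (Fin N → ℝ) := Set.Icc (fun _ => 0) (fun _ => 1 / (N : ℝ)) with hB
  set v0 : Fin N → ℝ := fun k => z 0 ^ ((k : ℕ) + 1) with hv0
  have hsub : (fun y => v0 + y) '' (Matrix.toLin' A '' B) ⊆ momentSpace N := by
    rintro _ ⟨_, ⟨w, hw, rfl⟩, rfl⟩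
    have hw0 : ∀ j, 0 ≤ w j := fun j => hw.1 j
    have hw1 : ∑ j, w j ≤ 1 := by
      calc ∑ j, w j ≤ ∑ _j : Fin N, 1 / (N : ℝ) := Finset.sum_le_sum fun j _ => hw.2 j
        _ ≤ 1 := by
          rcases Nat.eq_zero_or_pos N with h | h
          · subst h; simp
          · simp
            rw [mul_inv_cancel₀ (by positivity)]
    have := sum_mul_pow_mem_momentSpace (N := N) z
      (Fin.cons (α := fun _ => ℝ) (1 - ∑ j, w j) w) hz
      (fun j => by refine Fin.cases ?_ (fun j => ?_) j <;> simp [hw0, hw1])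
      (by simp [Fin.sum_univ_succ])
    convert this using 1
    ext k
    simp only [hv0, hA, Pi.add_apply, Matrix.toLin'_apply, Matrix.mulVec, dotProduct,
      Matrix.of_apply, Fin.sum_univ_succ, Fin.cons_zero, Fin.cons_succ, sub_mul, mul_one,
      Finset.sum_sub_distrib, one_mul, Finset.sum_mul]
    simp only [mul_comm]
    ring
  refine le_trans (le_of_eq ?_) (measure_mono hsub)
  rw [Set.image_add_left, measure_preimage_add, Measure.addHaar_image_linearMap,
    LinearMap.det_toLin', hdet, hB, Real.volume_Icc_pi, ENNReal.ofReal_mul (Real.sqrt_nonneg _)]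
  rw [ENNReal.ofReal_pow (by positivity)]
  simp

/-- Chebyshev's extremal property: if the product stayed below 4^(-n) on [0,1], then after rescaling
to [-1,1] and multiplying by 4^n it would be bounded by 1 with leading coefficient 2^n, above the
maximum 2^(n-1). -/
theorem exists_abs_prod_sub_ge {n : ℕ} (z : Fin n → ℝ) :
    ∃ t ∈ Set.Icc (0 : ℝ) 1, (1 / 4) ^ n ≤ ∏ j, |t - z j| := by
  rcases Nat.eq_zero_or_pos n with h | hn
  · subst h; exact ⟨0, by simp, by simp⟩
  by_contra! hcon
  set p : ℝ[X] := ∏ j, (Polynomial.C (1 / 2) * Polynomial.X - Polynomial.C (z j - 1 / 2)) with hp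
  have hdeg : ∀ j, (Polynomial.C (1 / 2) * Polynomial.X - Polynomial.C (z j - 1 / 2)).degree
      = 1 := fun j => by
    rw [sub_eq_add_neg, ← Polynomial.C_neg]
    exact Polynomial.degree_linear (by norm_num)
  have hlead : ∀ j, (Polynomial.C (1 / 2) * Polynomial.X
      - Polynomial.C (z j - 1 / 2)).leadingCoeff = 1 / 2 := fun j => by
    rw [sub_eq_add_neg, ← Polynomial.C_neg]
    exact Polynomial.leadingCoeff_linear (by norm_num)
  have hq := Polynomial.Chebyshev.leadingCoeff_le_of_forall_abs_le_one (n := n)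
    (P := Polynomial.C (4 ^ n) * p) ?_ ?_
  · rw [Polynomial.leadingCoeff_mul, Polynomial.leadingCoeff_C, hp,
      Polynomial.leadingCoeff_prod] at hq
    simp only [hlead, Finset.prod_const, Finset.card_univ, Fintype.card_fin] at hq
    rw [← mul_pow] at hq
    norm_num at hq
    exact absurd hq (not_le.2 (pow_lt_pow_right₀ (by norm_num) (by omega)))
  · rw [Polynomial.degree_C_mul (by positivity), hp, Polynomial.degree_prod]
    simp only [hdeg]
    simp
  · intro x hx
    have := hcon ((x + 1) / 2) ⟨by linarith [hx.1], by linarith [hx.2]⟩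
    rw [Polynomial.eval_mul, Polynomial.eval_C, hp, Polynomial.eval_prod, abs_mul,
      Finset.abs_prod, abs_of_pos (by positivity : (0 : ℝ) < 4 ^ n)]
    have h2 : ∀ j, |Polynomial.eval x (Polynomial.C (1 / 2) * Polynomial.X
        - Polynomial.C (z j - 1 / 2))| = |(x + 1) / 2 - z j| := fun j => by
      congr 1; simp; ring
    simp only [h2]
    calc 4 ^ n * ∏ j, |(x + 1) / 2 - z j| ≤ 4 ^ n * (1 / 4) ^ n := by gcongr
      _ = 1 := by rw [← mul_pow]; norm_num

theorem sepProd_snoc {n : ℕ} (z : Fin n → ℝ) (t : ℝ) :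
    sepProd (Fin.snoc (α := fun _ => ℝ) z t) = sepProd z * (∏ j, |t - z j|) ^ 2 := by
  have h1 : ∀ i : Fin n, i.castSucc ≠ Fin.last n := fun i => (Fin.castSucc_lt_last i).ne
  have h2 : ∀ i : Fin n, Fin.last n ≠ i.castSucc := fun i => (h1 i).symm
  simp only [sepProd, Fin.prod_univ_castSucc, Fin.snoc_castSucc, Fin.snoc_last, h1, h2, if_false,
    if_true, Finset.prod_mul_distrib, Fin.castSucc_inj, mul_one, abs_sub_comm _ t]
  ring

/-- Leja points of `[0,1]`. -/
theorem exists_sepProd_ge (n : ℕ) :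
    ∃ z : Fin n → ℝ, (∀ j, z j ∈ Set.Icc (0 : ℝ) 1) ∧ (1 / 4) ^ (n * (n - 1)) ≤ sepProd z := by
  induction n with
  | zero => exact ⟨fun _ => 0, by simp, by simp [sepProd]⟩
  | succ n ih =>
    obtain ⟨z, hz, hsep⟩ := ih
    obtain ⟨t, ht, htz⟩ := exists_abs_prod_sub_ge z
    refine ⟨Fin.snoc (α := fun _ => ℝ) z t, fun j => ?_, ?_⟩
    · refine Fin.lastCases ?_ (fun j => ?_) j
      · simpa using ht
      · simpa using hz j
    · rw [sepProd_snoc]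
      have : (n + 1) * (n + 1 - 1) = n * (n - 1) + n * 2 := by
        cases n <;> simp; ring
      rw [this, pow_add, pow_mul _ n 2]
      exact mul_le_mul hsep (by gcongr) (by positivity) (sepProd_nonneg z)

theorem volume_momentSpace_ge_pow (N : ℕ) :
    ENNReal.ofReal ((1 / 2) ^ (N * (N + 1)) * (1 / (N : ℝ)) ^ N) ≤ volume (momentSpace N) := by
  obtain ⟨z, hz, hsep⟩ := exists_sepProd_ge (N + 1)
  refine le_trans (ENNReal.ofReal_le_ofReal ?_) (volume_momentSpace_ge z hz)
  gcongr
  refine Real.le_sqrt_of_sq_le (le_trans (le_of_eq ?_) hsep)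
  rw [← pow_mul, mul_comm _ 2, pow_mul, mul_comm N]
  norm_num

/-! ### Discrete measures as coordinates on the moment space, and their Jacobian. -/

/-- Positions of the weights and of the nodes among the `2 * m + 1` parameters of a discrete
probability measure with `m + 1` atoms. -/
def paramEquiv (m : ℕ) : Fin m ⊕ Fin (m + 1) ≃ Fin (2 * m + 1) :=
  finSumFinEquiv.trans (finCongr (by omega))

/-- The atoms encoded by a parameter. -/
def nodes {m : ℕ} (y : Fin (2 * m + 1) → ℝ) : Fin (m + 1) → ℝ :=
  fun j => y (paramEquiv m (Sum.inr j))

/-- The weights encoded by a parameter; the last one makes the total mass equal to `1`. -/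
def weights {m : ℕ} (y : Fin (2 * m + 1) → ℝ) : Fin (m + 1) → ℝ :=
  Fin.snoc (α := fun _ => ℝ) (fun j => y (paramEquiv m (Sum.inl j)))
    (1 - ∑ j, y (paramEquiv m (Sum.inl j)))

/-- The moments of order `1, …, 2 * m + 1` of the discrete measure encoded by a parameter. -/
def momentMap {m : ℕ} (y : Fin (2 * m + 1) → ℝ) : Fin (2 * m + 1) → ℝ :=
  fun k => ∑ j, weights y j * nodes y j ^ ((k : ℕ) + 1)

/-- The Jacobian matrix of `momentMap`. -/
def momentJacobian {m : ℕ} (y : Fin (2 * m + 1) → ℝ) :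
    Matrix (Fin (2 * m + 1)) (Fin (2 * m + 1)) ℝ :=
  Matrix.of fun k c => Sum.elim
    (fun j : Fin m => nodes y j.castSucc ^ ((k : ℕ) + 1) - nodes y (Fin.last m) ^ ((k : ℕ) + 1))
    (fun j => weights y j * (((k : ℕ) + 1 : ℕ) * nodes y j ^ (k : ℕ))) ((paramEquiv m).symm c)

theorem weights_castSucc {m : ℕ} (y : Fin (2 * m + 1) → ℝ) (j : Fin m) :
    weights y j.castSucc = y (paramEquiv m (Sum.inl j)) := by simp [weights]

theorem weights_last {m : ℕ} (y : Fin (2 * m + 1) → ℝ) :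
    weights y (Fin.last m) = 1 - ∑ j, y (paramEquiv m (Sum.inl j)) := by simp [weights]

theorem sum_weights {m : ℕ} (y : Fin (2 * m + 1) → ℝ) : ∑ j, weights y j = 1 := by
  simp [Fin.sum_univ_castSucc, weights_castSucc, weights_last]

theorem continuous_nodes {m : ℕ} : Continuous (nodes (m := m)) :=
  continuous_pi fun _ => continuous_apply _

theorem continuous_weights {m : ℕ} : Continuous (weights (m := m)) := by
  refine continuous_pi fun j => ?_
  refine Fin.lastCases ?_ (fun j => ?_) j
  · simp only [weights_last]; fun_prop
  · simp only [weights_castSucc]; fun_prop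

theorem continuous_momentMap {m : ℕ} : Continuous (momentMap (m := m)) := by
  refine continuous_pi fun k => continuous_finsetSum _ fun j _ => ?_
  exact ((continuous_apply j).comp continuous_weights).mul
    (((continuous_apply j).comp continuous_nodes).pow _)

theorem hasFDerivAt_momentMap {m : ℕ} (y : Fin (2 * m + 1) → ℝ) :
    HasFDerivAt momentMap (Matrix.toLin' (momentJacobian y)).toContinuousLinearMap y := by
  have hproj : ∀ c, HasFDerivAt (fun y : Fin (2 * m + 1) → ℝ => y c)
      (ContinuousLinearMap.proj (R := ℝ) (φ := fun _ => ℝ) c) y := fun c =>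
    hasFDerivAt_apply c y
  refine hasFDerivAt_pi'' fun k => ?_
  have hx : ∀ j : Fin (m + 1), HasFDerivAt (fun y : Fin (2 * m + 1) → ℝ =>
      nodes y j ^ ((k : ℕ) + 1)) _ y := fun j =>
    (hproj (paramEquiv m (Sum.inr j))).pow ((k : ℕ) + 1)
  have hw : ∀ j : Fin m, HasFDerivAt (fun y : Fin (2 * m + 1) → ℝ =>
      weights y j.castSucc) (ContinuousLinearMap.proj (R := ℝ) (φ := fun _ => ℝ)
        (paramEquiv m (Sum.inl j))) y := fun j => by
    simp only [weights_castSucc]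
    exact hproj (paramEquiv m (Sum.inl j))
  have hl : HasFDerivAt (fun y : Fin (2 * m + 1) → ℝ => weights y (Fin.last m))
      (-∑ j, ContinuousLinearMap.proj (R := ℝ) (φ := fun _ => ℝ) (paramEquiv m (Sum.inl j))) y := by
    simp only [weights_last]
    exact (HasFDerivAt.fun_sum fun j (_ : j ∈ Finset.univ) =>
      hproj (paramEquiv m (Sum.inl j))).const_sub 1
  have hmain := (HasFDerivAt.fun_sum fun j (_ : j ∈ Finset.univ) => (hw j).mul (hx j.castSucc)).add
    (hl.mul (hx (Fin.last m)))
  have hfun : (fun y : Fin (2 * m + 1) → ℝ => momentMap y k) = fun y =>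
      (∑ j : Fin m, weights y j.castSucc * nodes y j.castSucc ^ ((k : ℕ) + 1))
        + weights y (Fin.last m) * nodes y (Fin.last m) ^ ((k : ℕ) + 1) := by
    ext y
    rw [momentMap, Fin.sum_univ_castSucc]
  rw [hfun]
  refine hmain.congr_fderiv ?_
  ext v
  simp only [add_apply, sum_apply, smul_apply, ContinuousLinearMap.proj_apply, smul_eq_mul,
    neg_apply, ContinuousLinearMap.comp_apply,
    LinearMap.coe_toContinuousLinearMap', Matrix.toLin'_apply, Matrix.mulVec, dotProduct,
    momentJacobian, Matrix.of_apply]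
  rw [← (paramEquiv m).sum_comp, Fintype.sum_sum_type]
  simp only [Equiv.symm_apply_apply, Sum.elim_inl, Sum.elim_inr]
  rw [Fin.sum_univ_castSucc (n := m)]
  simp only [Finset.sum_add_distrib, sub_mul, Finset.sum_sub_distrib, ← Finset.mul_sum, nodes,
    add_tsub_cancel_right, nsmul_eq_mul]
  simp only [mul_comm, mul_left_comm]
  ring

/-- Adjoining the zeroth moment row and the column of the last node gives a confluent Vandermonde
matrix. Eliminating that column restores the differences caused by the constraint on the total mass,
and each derivative column contributes its weight. -/
theorem abs_det_momentJacobian {m : ℕ} (y : Fin (2 * m + 1) → ℝ) :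
    |(momentJacobian y).det| = (∏ j, |weights y j|) * sepProd (nodes y) ^ 2 := by
  let col : Unit ⊕ (Fin m ⊕ Fin (m + 1)) → Fin (m + 1) ⊕ Fin (m + 1) :=
    Sum.elim (fun _ => Sum.inl (Fin.last m)) (Sum.elim (fun j => Sum.inl j.castSucc) Sum.inr)
  have hcol : Function.Bijective col := by
    refine (Fintype.bijective_iff_injective_and_card col).2 ⟨?_, by simp; ring⟩
    rintro (a | a | a) (b | b | b) h <;>
      simp_all [col, (Fin.castSucc_lt_last _).ne, (Fin.castSucc_lt_last _).ne']
  let row : Unit ⊕ (Fin m ⊕ Fin (m + 1)) → Fin (2 * m + 2) :=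
    Sum.elim (fun _ => 0) fun k => (paramEquiv m k).succ
  have hrow : Function.Bijective row := by
    refine (Fintype.bijective_iff_injective_and_card row).2 ⟨?_, by simp; ring⟩
    rintro (a | a) (b | b) h <;> simp_all [row, Fin.succ_ne_zero, (Fin.succ_ne_zero _).symm]
  let g := Equiv.ofBijective col hcol
  let g' := Equiv.ofBijective row hrow
  have hconf := abs_det_confluent (g.symm.trans g') (nodes y)
  rw [← Matrix.abs_det_submatrix_equiv_equiv g g,
    det_eliminate (fun k => nodes y (Fin.last m) ^ (g' k : ℕ)) (Sum.elim (fun _ => 1) fun _ => 0)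
      (fun k j => Sum.elim (fun j => nodes y j.castSucc ^ ((paramEquiv m k : ℕ) + 1))
        (fun j => (((paramEquiv m k : ℕ) + 1 : ℕ) : ℝ) * nodes y j ^ (paramEquiv m k : ℕ)) j)]
    at hconf
  · have hJ : (momentJacobian y).submatrix (paramEquiv m) (paramEquiv m)
        = (Matrix.of fun k j => Sum.elim
          (fun j => nodes y j.castSucc ^ ((paramEquiv m k : ℕ) + 1))
          (fun j => (((paramEquiv m k : ℕ) + 1 : ℕ) : ℝ) * nodes y j ^ (paramEquiv m k : ℕ)) j
            - nodes y (Fin.last m) ^ (g' (Sum.inr k) : ℕ) *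
              Sum.elim (fun _ => 1) (fun _ => 0) j)
          * Matrix.diagonal (Sum.elim (fun _ : Fin m => (1 : ℝ)) (weights y)) := by
      ext k j
      rcases j with j | j
      · simp [momentJacobian, Matrix.mul_diagonal, g', row]
      · simp [momentJacobian, Matrix.mul_diagonal, g', row]
        ring
    rw [← Matrix.abs_det_submatrix_equiv_equiv (paramEquiv m) (paramEquiv m), hJ, Matrix.det_mul,
      abs_mul, hconf, Matrix.det_diagonal, Fintype.prod_sum_type]
    simp [Finset.abs_prod, mul_comm]
  · simp [g', row]
  · intro k
    simp only [Matrix.submatrix_apply, Matrix.of_apply, Equiv.trans_apply, g.symm_apply_apply]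
    simp [g, col]
  · intro j
    simp only [Matrix.submatrix_apply, Matrix.of_apply, Equiv.trans_apply, g.symm_apply_apply]
    rcases j with j | j <;> simp [g', g, col, row]
  · intro k j
    simp only [Matrix.submatrix_apply, Matrix.of_apply, Equiv.trans_apply, g.symm_apply_apply]
    rcases j with j | j <;> simp [g', g, col, row]

/-- The parameters of the probability measures on `[0,1]` with `m + 1` atoms. -/
def paramSpace (m : ℕ) : Set (Fin (2 * m + 1) → ℝ) :=
  {y | (∀ j, nodes y j ∈ Set.Icc (0 : ℝ) 1) ∧ ∀ j, 0 ≤ weights y j}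

theorem weights_le_one {m : ℕ} {y : Fin (2 * m + 1) → ℝ} (hy : y ∈ paramSpace m)
    (j : Fin (m + 1)) : weights y j ≤ 1 := by
  rw [← sum_weights y]
  exact Finset.single_le_sum (fun i _ => hy.2 i) (Finset.mem_univ j)

theorem paramSpace_subset {m : ℕ} : paramSpace m ⊆ Set.Icc (fun _ => 0) fun _ => 1 := by
  intro y hy
  have : ∀ c, y c ∈ Set.Icc (0 : ℝ) 1 := by
    intro c
    obtain ⟨c, rfl⟩ := (paramEquiv m).surjective c
    rcases c with j | j
    · rw [← weights_castSucc y j]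
      exact ⟨hy.2 _, weights_le_one hy _⟩
    · exact hy.1 j
  exact ⟨fun c => (this c).1, fun c => (this c).2⟩

theorem isCompact_paramSpace (m : ℕ) : IsCompact (paramSpace m) := by
  refine isCompact_Icc.of_isClosed_subset ?_ paramSpace_subset
  simp only [paramSpace, Set.ofPred_and, Set.ofPred_forall]
  refine IsClosed.inter (isClosed_iInter fun j => ?_) (isClosed_iInter fun j => ?_)
  · exact isClosed_Icc.preimage ((continuous_apply j).comp continuous_nodes)
  · exact isClosed_Ici.preimage ((continuous_apply j).comp continuous_weights)

/-- The area inequality needs no injectivity of `momentMap`, and the parameters lie in a cube of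
volume 1. -/
theorem volume_image_momentMap_le {m : ℕ} {S : Set (Fin (2 * m + 1) → ℝ)} (hS : MeasurableSet S)
    (hsub : S ⊆ paramSpace m) {b : ℝ}
    (hb : ∀ y ∈ S, (∏ j, |weights y j|) * sepProd (nodes y) ^ 2 ≤ b) :
    volume (momentMap '' S) ≤ ENNReal.ofReal b := by
  refine (addHaar_image_le_lintegral_abs_det_fderiv volume hS
    fun y _ => (hasFDerivAt_momentMap y).hasFDerivWithinAt).trans ?_
  calc ∫⁻ y in S, ENNReal.ofReal
        |(Matrix.toLin' (momentJacobian y)).toContinuousLinearMap.det| ∂volume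
      ≤ ∫⁻ _ in S, ENNReal.ofReal b ∂volume := by
        refine setLIntegral_mono' hS fun y hy => ENNReal.ofReal_le_ofReal ?_
        rw [LinearMap.det_toContinuousLinearMap, LinearMap.det_toLin', abs_det_momentJacobian]
        exact hb y hy
    _ = ENNReal.ofReal b * volume S := by simp
    _ ≤ ENNReal.ofReal b * volume (Set.Icc (fun _ => 0) fun _ => 1 : Set (Fin (2 * m + 1) → ℝ)) :=
        mul_le_mul_right (measure_mono (hsub.trans paramSpace_subset)) _
    _ = ENNReal.ofReal b := by simp [Real.volume_Icc_pi]

theorem prod_abs_weights_le_one {m : ℕ} {y : Fin (2 * m + 1) → ℝ} (hy : y ∈ paramSpace m) :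
    ∏ j, |weights y j| ≤ 1 :=
  Finset.prod_le_one (fun _ _ => abs_nonneg _) fun j _ => by
    rw [abs_of_nonneg (hy.2 j)]; exact weights_le_one hy j

/-! ### Logarithmic energy estimate by Fourier series. -/

/-- The squared modulus of `1 - r * exp (i α)`. -/
def distSq (r α : ℝ) : ℝ := 1 - 2 * r * Real.cos α + r ^ 2

theorem le_distSq {r : ℝ} (hr : 0 ≤ r) (α : ℝ) : (1 - r) ^ 2 ≤ distSq r α := by
  unfold distSq
  nlinarith [mul_nonneg hr (sub_nonneg.2 (Real.cos_le_one α))]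

/-- The difference of the two sides is 2 (1 - r)^2 (1 + cos α). This replaces the singular kernel at
radius 1 by the regularised one at radius `r`. -/
theorem distSq_one_le {r : ℝ} (α : ℝ) :
    (1 + r) ^ 2 * distSq 1 α ≤ 4 * distSq r α := by
  unfold distSq
  nlinarith [mul_nonneg (sq_nonneg (1 - r)) (by linarith [Real.neg_one_le_cos α] :
    0 ≤ 1 + Real.cos α)]

/-- Real part of the Taylor series of -2 log(1 - z) at z = r exp(iα), up to sign. The term `m = 0`
is 0 by the convention for division by zero. -/
theorem hasSum_log_distSq {r : ℝ} (hr0 : 0 ≤ r) (hr1 : r < 1) (α : ℝ) :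
    HasSum (fun m : ℕ => -(2 * r ^ m / m * Real.cos (m * α))) (Real.log (distSq r α)) := by
  set z : ℂ := r * Complex.exp (α * Complex.I) with hz
  have hznorm : ‖z‖ = r := by simp [hz, Complex.norm_exp_ofReal_mul_I, abs_of_nonneg hr0]
  have h := Complex.hasSum_taylorSeries_neg_log (z := z) (by rw [hznorm]; exact hr1)
  have h2 := (Complex.hasSum_re h).mul_left (-2)
  have hval : -2 * (-Complex.log (1 - z)).re = Real.log (distSq r α) := by
    rw [Complex.neg_re, Complex.log_re]
    have : distSq r α = ‖1 - z‖ ^ 2 := by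
      have hre : z.re = r * Real.cos α := by
        rw [hz, Complex.re_ofReal_mul, Complex.exp_ofReal_mul_I_re]
      have him : z.im = r * Real.sin α := by
        rw [hz, Complex.im_ofReal_mul, Complex.exp_ofReal_mul_I_im]
      rw [← Complex.normSq_eq_norm_sq, Complex.normSq_apply, distSq, Complex.sub_re,
        Complex.sub_im, hre, him, Complex.one_re, Complex.one_im]
      linear_combination -r ^ 2 * Real.sin_sq_add_cos_sq α
    rw [this, Real.log_pow]
    push_cast
    ring
  rw [hval] at h2
  refine h2.congr_fun ?_
  intro m
  have : z ^ m = (r ^ m : ℝ) * Complex.exp ((m * α : ℝ) * Complex.I) := by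
    rw [hz, mul_pow, ← Complex.exp_nat_mul]
    push_cast
    ring_nf
  rw [this, ← Complex.ofReal_natCast, Complex.div_ofReal_re, Complex.re_ofReal_mul,
    Complex.exp_ofReal_mul_I_re]
  ring

/-- Since cos m(θ - φ) + cos m(θ + φ) = 2 cos mθ cos mφ, summing over pairs makes every Fourier mode
of the log-product minus a square. All modes but the `k`-th may therefore be dropped. -/
theorem prod_distSq_le {ι : Type*} [Fintype ι] {r : ℝ} (hr0 : 0 ≤ r) (hr1 : r < 1) (θ : ι → ℝ)
    (k : ℕ) :
    ∏ i, ∏ j, (distSq r (θ i - θ j) * distSq r (θ i + θ j))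
      ≤ Real.exp (-(4 * r ^ k / k * (∑ i, Real.cos (k * θ i)) ^ 2)) := by
  have hpos : ∀ α, 0 < distSq r α := fun α =>
    lt_of_lt_of_le (by nlinarith) (le_distSq hr0 α)
  have hsum : HasSum (fun m : ℕ => -(4 * r ^ m / m * (∑ i, Real.cos (m * θ i)) ^ 2))
      (∑ i, ∑ j, (Real.log (distSq r (θ i - θ j)) + Real.log (distSq r (θ i + θ j)))) := by
    refine (hasSum_sum fun i _ => hasSum_sum fun j _ =>
      (hasSum_log_distSq hr0 hr1 (θ i - θ j)).add
        (hasSum_log_distSq hr0 hr1 (θ i + θ j))).congr_fun fun m => ?_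
    have : ∀ i j, -(2 * r ^ m / m * Real.cos (m * (θ i - θ j)))
        + -(2 * r ^ m / m * Real.cos (m * (θ i + θ j)))
        = -(4 * r ^ m / m) * (Real.cos (m * θ i) * Real.cos (m * θ j)) := by
      intro i j
      rw [mul_sub, mul_add, Real.cos_sub, Real.cos_add]
      ring
    simp only [this, ← Finset.mul_sum]
    rw [sq, Finset.sum_mul_sum, Finset.sum_congr rfl fun i _ => (Finset.mul_sum _ _ _).symm]
    simp only [Finset.mul_sum]
    rw [← Finset.sum_neg_distrib]
    simp only [← Finset.sum_neg_distrib]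
    exact Finset.sum_congr rfl fun i _ => Finset.sum_congr rfl fun j _ => by ring
  have hle : ∑ i, ∑ j, (Real.log (distSq r (θ i - θ j)) + Real.log (distSq r (θ i + θ j)))
      ≤ -(4 * r ^ k / k * (∑ i, Real.cos (k * θ i)) ^ 2) := by
    have := le_hasSum hsum.neg k (fun m _ => by rw [neg_neg]; positivity)
    linarith
  refine le_trans (le_of_eq ?_) (Real.exp_le_exp.2 hle)
  simp only [Real.exp_sum, Real.exp_add, Real.exp_log (hpos _)]

theorem sq_sub_eq_distSq (θ φ : ℝ) :
    16 * ((Real.cos θ + 1) / 2 - (Real.cos φ + 1) / 2) ^ 2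
      = distSq 1 (θ - φ) * distSq 1 (θ + φ) := by
  unfold distSq
  rw [Real.cos_sub, Real.cos_add]
  have h1 := Real.sin_sq_add_cos_sq θ
  have h2 := Real.sin_sq_add_cos_sq φ
  have h1' : Real.sin θ ^ 2 = 1 - Real.cos θ ^ 2 := by linarith
  have h2' : Real.sin φ ^ 2 = 1 - Real.cos φ ^ 2 := by linarith
  ring_nf
  rw [h1', h2']
  ring

/-- Energy estimate for points of `[0,1]`: the product of the distances is exponentially small
at speed `n ^ 2` unless the Chebyshev moment of order `k` is small. -/
theorem sepProd_sq_le {ι : Type*} [Fintype ι] [DecidableEq ι] {r : ℝ} (hr0 : 0 ≤ r) (hr1 : r < 1)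
    (x : ι → ℝ) (hx : ∀ j, x j ∈ Set.Icc (0 : ℝ) 1) (k : ℕ) :
    sepProd x ^ 2 ≤ (((1 + r) ^ 4)⁻¹) ^ (Fintype.card ι ^ 2)
      * ((1 + r) ^ 4 / (1 - r) ^ 4) ^ Fintype.card ι
      * Real.exp (-(4 * r ^ k / k *
          (∑ i, (Polynomial.Chebyshev.T ℝ k).eval (2 * x i - 1)) ^ 2)) := by
  set θ : ι → ℝ := fun i => Real.arccos (2 * x i - 1) with hθ
  have hcos : ∀ i, Real.cos (θ i) = 2 * x i - 1 := fun i =>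
    Real.cos_arccos (by linarith [(hx i).1]) (by linarith [(hx i).2])
  have hT : ∀ i, (Polynomial.Chebyshev.T ℝ k).eval (2 * x i - 1) = Real.cos (k * θ i) := fun i => by
    rw [← hcos, Polynomial.Chebyshev.T_real_cos]
    simp
  simp only [hT]
  set c : ℝ := ((1 + r) ^ 4)⁻¹ with hc
  set C : ℝ := (1 + r) ^ 4 / (1 - r) ^ 4 with hC
  have hr1' : 0 < 1 - r := by linarith
  have hpos : ∀ α, 0 < distSq r α := fun α =>
    lt_of_lt_of_le (by positivity) (le_distSq hr0 α)
  have h1nn : ∀ α, 0 ≤ distSq 1 α := fun α => by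
    have := le_distSq (r := 1) zero_le_one α
    linarith
  have hterm : ∀ i j, (if i = j then 1 else |x i - x j|) ^ 2
      ≤ c * (if i = j then C else 1) * (distSq r (θ i - θ j) * distSq r (θ i + θ j)) := by
    intro i j
    split_ifs with hij
    -- The regularised kernel does not vanish on the diagonal; `C` compensates for its size there
    -- and enters only to the power of the number of points.
    · have h4 : (1 - r) ^ 2 * (1 - r) ^ 2 ≤ distSq r (θ i - θ j) * distSq r (θ i + θ j) :=
        mul_le_mul (le_distSq hr0 _) (le_distSq hr0 _) (by positivity) (hpos _).le
      have h5 : c * C * ((1 - r) ^ 2 * (1 - r) ^ 2) = 1 := by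
        rw [hc, hC]; field_simp
      rw [one_pow, ← h5]
      gcongr
    · have h4 := mul_le_mul (distSq_one_le (r := r) (θ i - θ j)) (distSq_one_le (r := r) (θ i + θ j))
        (mul_nonneg (by positivity) (h1nn _)) (by have := hpos (θ i - θ j); positivity)
      have h5 : 16 * (x i - x j) ^ 2 = distSq 1 (θ i - θ j) * distSq 1 (θ i + θ j) := by
        rw [← sq_sub_eq_distSq, hcos, hcos]
        ring
      rw [sq_abs, mul_one, hc, inv_mul_eq_div, le_div_iff₀ (by positivity)]
      have h6 : 16 * ((x i - x j) ^ 2 * (1 + r) ^ 4) = (1 + r) ^ 2 * distSq 1 (θ i - θ j) *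
          ((1 + r) ^ 2 * distSq 1 (θ i + θ j)) := by
        linear_combination (1 + r) ^ 4 * h5
      linarith
  have hprod : sepProd x ^ 2 ≤ ∏ i, ∏ j, (c * (if i = j then C else 1) *
      (distSq r (θ i - θ j) * distSq r (θ i + θ j))) := by
    unfold sepProd
    rw [← Finset.prod_pow]
    refine Finset.prod_le_prod (fun i _ => sq_nonneg _) fun i _ => ?_
    rw [← Finset.prod_pow]
    exact Finset.prod_le_prod (fun j _ => sq_nonneg _) fun j _ => hterm i j
  refine hprod.trans ?_
  simp only [Finset.prod_mul_distrib]
  have e1 : ∏ _i : ι, ∏ _j : ι, c = c ^ (Fintype.card ι ^ 2) := by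
    simp [Finset.card_univ, ← pow_mul, sq]
  have e2 : ∏ i : ι, ∏ j : ι, (if i = j then C else 1) = C ^ Fintype.card ι := by
    simp [Finset.card_univ]
  rw [e1, e2]
  have := prod_distSq_le hr0 hr1 θ k
  simp only [Finset.prod_mul_distrib] at this
  gcongr

/-! ### Gauss quadrature for an arbitrary probability measure on [0,1]. -/

section Quadrature

variable (η : Measure (Set.Icc (0 : ℝ) 1)) [IsProbabilityMeasure η]

theorem integrable_eval (p : ℝ[X]) : Integrable (fun x : Set.Icc (0 : ℝ) 1 => p.eval (x : ℝ)) η :=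
  (by fun_prop : Continuous fun x : Set.Icc (0 : ℝ) 1 =>
    p.eval (x : ℝ)).integrable_of_hasCompactSupport (HasCompactSupport.of_compactSpace _)

/-- A monic polynomial that is orthogonal to all polynomials of smaller degree. -/
theorem exists_monic_orthogonal (n : ℕ) :
    ∃ P : ℝ[X], P.Monic ∧ P.natDegree = n ∧
      ∀ q : ℝ[X], q.degree < n → ∫ x, (P * q).eval (x : ℝ) ∂η = 0 := by
  let toL : ℝ[X] →ₗ[ℝ] Lp ℝ 2 η :=
    (ContinuousMap.toLp 2 η ℝ).toLinearMap ∘ₗ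
      (Polynomial.toContinuousMapOnAlgHom (Set.Icc (0 : ℝ) 1)).toLinearMap
  have hinner : ∀ p q : ℝ[X], inner ℝ (toL p) (toL q) = ∫ x, (q * p).eval (x : ℝ) ∂η := by
    intro p q
    simp only [toL, LinearMap.comp_apply]
    refine (ContinuousMap.inner_toLp (𝕜 := ℝ) η _ _).trans ?_
    simp
  let K : Submodule ℝ (Lp ℝ 2 η) := (Polynomial.degreeLT ℝ n).map toL
  have : FiniteDimensional ℝ (Polynomial.degreeLT ℝ n) :=
    Module.Finite.equiv (Polynomial.degreeLTEquiv ℝ n).symm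
  have : FiniteDimensional ℝ K := inferInstance
  -- If `η` has finite support, `toL` is not injective; any preimage of the projection with degree
  -- below `n` serves.
  obtain ⟨q0, hq0, hq0'⟩ := K.starProjection_apply_mem (toL (Polynomial.X ^ n))
  have hq0d : q0.degree < n := Polynomial.mem_degreeLT.1 hq0
  have hlt : q0.degree < (Polynomial.X ^ n : ℝ[X]).degree := by rwa [Polynomial.degree_X_pow]
  refine ⟨Polynomial.X ^ n - q0, (Polynomial.monic_X_pow n).sub_of_left hlt, ?_, fun q hq => ?_⟩
  · refine Polynomial.natDegree_eq_of_degree_eq_some ?_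
    rw [Polynomial.degree_sub_eq_left_of_degree_lt hlt, Polynomial.degree_X_pow]
  · have := K.starProjection_inner_eq_zero (toL (Polynomial.X ^ n)) (toL q)
      ⟨q, Polynomial.mem_degreeLT.2 hq, rfl⟩
    rw [← hq0', ← map_sub, ← real_inner_comm, hinner] at this
    exact this

/-- The product of `P` with the test polynomial `Q` is Q^2 S, of constant sign with zero integral,
hence zero almost everywhere. -/
theorem ae_eval_eq_zero_of_factor {n : ℕ} {P Q S : ℝ[X]}
    (hP : ∀ q : ℝ[X], q.degree < n → ∫ x, (P * q).eval (x : ℝ) ∂η = 0)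
    (hPQ : P = Q * S) (hQ : Q.degree < n)
    (hS : (∀ x ∈ Set.Icc (0 : ℝ) 1, 0 ≤ S.eval x) ∨ ∀ x ∈ Set.Icc (0 : ℝ) 1, S.eval x ≤ 0) :
    ∀ᵐ x : Set.Icc (0 : ℝ) 1 ∂η, P.eval (x : ℝ) = 0 := by
  have h := hP Q hQ
  have key : (fun x : Set.Icc (0 : ℝ) 1 => (P * Q).eval (x : ℝ)) =ᵐ[η] 0 := by
    rcases hS with hS | hS
    · refine (integral_eq_zero_iff_of_nonneg (fun x => ?_) (integrable_eval η _)).1 h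
      have := hS x x.2
      simp only [hPQ, Polynomial.eval_mul, Pi.zero_apply]
      nlinarith [mul_nonneg (sq_nonneg (Q.eval (x : ℝ))) this]
    · refine (integral_eq_zero_iff_of_nonneg_ae (f := fun x : Set.Icc (0 : ℝ) 1 => -((P * Q).eval (x : ℝ)))
        (Filter.Eventually.of_forall fun x => ?_)
        (integrable_eval η _).neg).1 (by rw [integral_neg, h, neg_zero]) |>.mono fun x hx => by
          simpa using hx
      have := hS x x.2
      simp only [hPQ, Polynomial.eval_mul, Pi.zero_apply]
      nlinarith [mul_nonneg (sq_nonneg (Q.eval (x : ℝ))) (neg_nonneg.2 this)]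
  filter_upwards [key] with x hx
  simp only [hPQ, Polynomial.eval_mul, Pi.zero_apply, mul_eq_zero] at hx ⊢
  tauto

theorem eval_nonneg_or_nonpos_of_no_roots {S : ℝ[X]} (hS : ∀ x, S.eval x ≠ 0) :
    (∀ x ∈ Set.Icc (0 : ℝ) 1, 0 ≤ S.eval x) ∨ ∀ x ∈ Set.Icc (0 : ℝ) 1, S.eval x ≤ 0 := by
  by_contra! hcon
  obtain ⟨⟨a, -, ha⟩, b, -, hb⟩ := hcon
  have := isPreconnected_univ.intermediate_value (Set.mem_univ a) (Set.mem_univ b)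
    S.continuous.continuousOn
  obtain ⟨c, -, hc⟩ := this ⟨ha.le, hb.le⟩
  exact hS c hc

/-- An orthogonal polynomial vanishes almost everywhere, or its roots are real, simple and lie in
the unit interval. -/
theorem ae_eval_eq_zero_or_roots {n : ℕ} {P : ℝ[X]} (hmonic : P.Monic) (hdeg : P.natDegree = n)
    (hP : ∀ q : ℝ[X], q.degree < n → ∫ x, (P * q).eval (x : ℝ) ∂η = 0) :
    (∀ᵐ x : Set.Icc (0 : ℝ) 1 ∂η, P.eval (x : ℝ) = 0) ∨
      (P.roots.Nodup ∧ Multiset.card P.roots = n ∧ ∀ a ∈ P.roots, a ∈ Set.Icc (0 : ℝ) 1) := by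
  by_cases hae : ∀ᵐ x : Set.Icc (0 : ℝ) 1 ∂η, P.eval (x : ℝ) = 0
  · exact Or.inl hae
  have hP0 : P ≠ 0 := hmonic.ne_zero
  -- A nonconstant factor of constant sign on [0,1] would leave a cofactor of degree below `n` to
  -- test against. This excludes double roots, root-free factors and roots outside [0,1].
  have hno : ∀ Q S : ℝ[X], P = Q * S → ((∀ x ∈ Set.Icc (0 : ℝ) 1, 0 ≤ S.eval x) ∨
      ∀ x ∈ Set.Icc (0 : ℝ) 1, S.eval x ≤ 0) → S.natDegree = 0 := by
    intro Q S hQS hS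
    by_contra hne
    refine hae (ae_eval_eq_zero_of_factor η hP hQS ?_ hS)
    have hQ0 : Q ≠ 0 := fun h => hP0 (by rw [hQS, h, zero_mul])
    have hS0 : S ≠ 0 := fun h => hP0 (by rw [hQS, h, mul_zero])
    rw [Polynomial.degree_eq_natDegree hQ0, Nat.cast_lt, ← hdeg, hQS,
      Polynomial.natDegree_mul hQ0 hS0]
    omega
  refine Or.inr ⟨?_, ?_, ?_⟩
  · rw [Multiset.nodup_iff_count_le_one]
    intro a
    by_contra! hcount
    rw [Polynomial.count_roots] at hcount
    obtain ⟨Q, hQ⟩ := (Polynomial.le_rootMultiplicity_iff hP0).1 hcount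
    have := hno Q ((Polynomial.X - Polynomial.C a) ^ (1 + 1)) (by rw [hQ]; ring)
      (Or.inl fun x _ => by simp; positivity)
    simp at this
  · obtain ⟨S, hS, hcard, hroots⟩ := Polynomial.exists_prod_multiset_X_sub_C_mul P
    have hS0 : S ≠ 0 := fun h => hP0 (by rw [← hS, h, mul_zero])
    have := hno _ S hS.symm (eval_nonneg_or_nonpos_of_no_roots fun x hx => by
      have : x ∈ S.roots := (Polynomial.mem_roots hS0).2 hx
      simp [hroots] at this)
    omega
  · intro a ha
    obtain ⟨Q, hQ⟩ := Polynomial.dvd_iff_isRoot.2 (Polynomial.isRoot_of_mem_roots ha)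
    by_contra hcon
    have := hno Q (Polynomial.X - Polynomial.C a) (by rw [hQ]; ring) (by
      rcases lt_or_ge a 0 with h | h
      · exact Or.inl fun x hx => by simp; linarith [hx.1]
      · have : 1 < a := by
          by_contra! h'
          exact hcon ⟨h, h'⟩
        exact Or.inr fun x hx => by simp; linarith [hx.2])
    simp at this

/-- Gauss quadrature. -/
theorem exists_quadrature {n : ℕ} :
    ∃ S : Finset ℝ, (∀ a ∈ S, a ∈ Set.Icc (0 : ℝ) 1) ∧ S.card ≤ n ∧
      ∀ p : ℝ[X], p.natDegree < 2 * n →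
        ∫ x, p.eval (x : ℝ) ∂η = ∑ a ∈ S, p.eval a * ∫ x, (Lagrange.basis S id a).eval (x : ℝ) ∂η := by
  obtain ⟨P, hmonic, hdeg, hP⟩ := exists_monic_orthogonal η n
  have hP0 := hmonic.ne_zero
  have hinterp : ∀ (S : Finset ℝ) (p : ℝ[X]),
      ∫ x, (Lagrange.interpolate S id fun a => p.eval a).eval (x : ℝ) ∂η
        = ∑ a ∈ S, p.eval a * ∫ x, (Lagrange.basis S id a).eval (x : ℝ) ∂η := by
    intro S p
    simp only [Lagrange.interpolate_apply, Polynomial.eval_finsetSum, Polynomial.eval_mul,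
      Polynomial.eval_C]
    rw [integral_finsetSum _ fun a _ => (integrable_eval η _).const_mul _]
    simp only [integral_const_mul]
  have hval : ∀ (S : Finset ℝ) (p : ℝ[X]), ∀ a ∈ S,
      (Lagrange.interpolate S id fun a => p.eval a).eval a = p.eval a := fun S p a ha =>
    Lagrange.eval_interpolate_at_node (v := id) _ (Function.injective_id.injOn) ha
  classical
  rcases ae_eval_eq_zero_or_roots η hmonic hdeg hP with hae | ⟨hnodup, hcard, hroots⟩
  -- Degenerate case: `η` is carried by the roots of `P` in [0,1], so interpolation there is exact
  -- almost everywhere.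
  · refine ⟨P.roots.toFinset.filter fun a => a ∈ Set.Icc (0 : ℝ) 1, fun a ha =>
      (Finset.mem_filter.1 ha).2, ?_, fun p _ => ?_⟩
    · exact (Finset.card_filter_le _ _).trans ((Multiset.toFinset_card_le _).trans
        (hdeg ▸ P.card_roots'))
    · rw [← hinterp]
      refine integral_congr_ae ?_
      filter_upwards [hae] with x hx
      exact (hval _ p x (by simp [hP0, hx, x.2.1, x.2.2])).symm
  · refine ⟨P.roots.toFinset, fun a ha => hroots a (by simpa using ha), ?_, fun p hp => ?_⟩
    · exact (Multiset.toFinset_card_le _).trans hcard.le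
    · set S := P.roots.toFinset with hS
      rw [← hinterp]
      set L := Lagrange.interpolate S id fun a => p.eval a with hL
      have hPprod : P = ∏ a ∈ S, (Polynomial.X - Polynomial.C a) := by
        have := Polynomial.prod_multiset_X_sub_C_of_monic_of_roots_card_eq hmonic
          (hcard.trans hdeg.symm)
        rw [← this, Finset.prod, hS, Multiset.toFinset_val, hnodup.dedup]
      have hdvd : P ∣ p - L := by
        rw [hPprod]
        refine Finset.prod_dvd_of_coprime ?_ fun a ha => ?_
        · intro a _ b _ hab
          exact Polynomial.pairwise_coprime_X_sub_C Function.injective_id hab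
        · rw [Polynomial.dvd_iff_isRoot, Polynomial.IsRoot, Polynomial.eval_sub, hval S p a ha,
            sub_self]
      obtain ⟨q, hq⟩ := hdvd
      have hScard : S.card = n := by rw [hS, Multiset.toFinset_card_of_nodup hnodup, hcard]
      have hLdeg : L.degree < n := by
        rw [← hScard]
        exact Lagrange.degree_interpolate_lt _ (Function.injective_id.injOn)
      have hqdeg : q.degree < n := by
        by_cases hq0 : q = 0
        · rw [hq0, Polynomial.degree_zero]; exact WithBot.bot_lt_coe n
        have hn : (p - L).natDegree < 2 * n := by
          have h2 : L.natDegree < 2 * n := by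
            by_cases hL0 : L = 0
            · rw [hL0, Polynomial.natDegree_zero]; omega
            · have := (Polynomial.natDegree_lt_iff_degree_lt hL0).2 hLdeg
              omega
          exact lt_of_le_of_lt (Polynomial.natDegree_sub_le _ _) (max_lt hp h2)
        rw [hq, Polynomial.natDegree_mul hP0 hq0, hdeg] at hn
        rw [← Polynomial.natDegree_lt_iff_degree_lt hq0]
        omega
      have := hP q hqdeg
      rw [← hq] at this
      simp only [Polynomial.eval_sub] at this
      rw [integral_sub (integrable_eval η _) (integrable_eval η _)] at this
      linarith

end Quadrature

/-! ### The moment space as an image, and roots of the orthogonal polynomial as nodes. -/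

theorem exists_param {m : ℕ} (x w : Fin (m + 1) → ℝ) (hw : ∑ j, w j = 1) :
    ∃ y : Fin (2 * m + 1) → ℝ, nodes y = x ∧ weights y = w := by
  refine ⟨fun c => Sum.elim (fun j : Fin m => w j.castSucc) x ((paramEquiv m).symm c), ?_, ?_⟩
  · ext j; simp [nodes]
  · ext j
    refine Fin.lastCases ?_ (fun j => ?_) j
    · rw [weights_last, ← hw, Fin.sum_univ_castSucc]; simp
    · rw [weights_castSucc]; simp

theorem momentSpace_eq_image (m : ℕ) : momentSpace (2 * m + 1) = momentMap '' paramSpace m := by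
  refine Set.Subset.antisymm ?_ ?_
  · rintro c ⟨η, hη, hc⟩
    obtain ⟨S, hS, hcard, hquad⟩ := exists_quadrature η (n := m + 1)
    set W : ℝ → ℝ := fun a => ∫ x, (Lagrange.basis S id a).eval (x : ℝ) ∂η with hW
    have hWnn : ∀ a ∈ S, 0 ≤ W a := by
      intro a ha
      -- The squared basis polynomial is within the exactness degree, so its nonnegative integral
      -- equals the weight.
      have h1 := hquad (Lagrange.basis S id a ^ 2) (by
        rw [Polynomial.natDegree_pow, Lagrange.natDegree_basis Function.injective_id.injOn ha]
        have := Finset.card_pos.2 ⟨a, ha⟩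
        omega)
      have h2 : ∑ b ∈ S, (Lagrange.basis S id a ^ 2).eval b * W b = W a := by
        rw [Finset.sum_eq_single_of_mem a ha]
        · have := Lagrange.eval_basis_self (v := id) Function.injective_id.injOn ha
          simp only [id] at this
          rw [Polynomial.eval_pow, this]
          simp
        · intro b hb hba
          have := Lagrange.eval_basis_of_ne (v := id) (s := S) hba.symm hb
          simp only [id] at this
          rw [Polynomial.eval_pow, this]
          simp
      rw [← h2, ← h1]
      exact integral_nonneg fun x => by simp only [Polynomial.eval_pow]; positivity
    have hWsum : ∑ a ∈ S, W a = 1 := by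
      have := hquad 1 (by simp)
      simpa using this.symm
    obtain ⟨f⟩ : Nonempty (S ↪ Fin (m + 1)) :=
      Function.Embedding.nonempty_of_card_le (by simpa using hcard)
    -- If there are fewer than `m + 1` atoms, the list is padded with atoms at 0 of weight 0.
    set x : Fin (m + 1) → ℝ := Function.extend f (fun a => (a : ℝ)) 0 with hx
    set w : Fin (m + 1) → ℝ := Function.extend f (fun a => W a) 0 with hw
    have hsum : ∀ g : ℝ → ℝ, ∑ j, w j * g (x j) = ∑ a ∈ S, W a * g a := by
      intro g
      rw [← Finset.sum_coe_sort S]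
      symm
      refine Fintype.sum_of_injective f f.injective _ _ (fun j hj => ?_) fun a => ?_
      · rw [hw, Function.extend_apply' _ _ _ (by simpa using hj)]; simp
      · rw [hw, hx, f.injective.extend_apply, f.injective.extend_apply]
    obtain ⟨y, hyx, hyw⟩ := exists_param x w (by
      have := hsum fun _ => 1
      simpa [hWsum] using this)
    have hall : ∀ j, x j ∈ Set.Icc (0 : ℝ) 1 ∧ 0 ≤ w j := by
      intro j
      by_cases hj : ∃ a, f a = j
      · obtain ⟨a, rfl⟩ := hj
        rw [hw, hx, f.injective.extend_apply, f.injective.extend_apply]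
        exact ⟨hS a a.2, hWnn a a.2⟩
      · rw [hw, hx, Function.extend_apply' _ _ _ hj, Function.extend_apply' _ _ _ hj]
        simp
    refine ⟨y, ⟨fun j => hyx ▸ (hall j).1, fun j => hyw ▸ (hall j).2⟩, ?_⟩
    ext k
    rw [momentMap, hyx, hyw, hsum fun t => t ^ ((k : ℕ) + 1), hc]
    have := hquad (Polynomial.X ^ ((k : ℕ) + 1)) (by rw [Polynomial.natDegree_X_pow]; omega)
    simp only [Polynomial.eval_pow, Polynomial.eval_X] at this
    rw [this]
    exact Finset.sum_congr rfl fun a _ => mul_comm _ _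
  · rintro _ ⟨y, hy, rfl⟩
    exact sum_mul_pow_mem_momentSpace _ _ hy.1 hy.2 (sum_weights y)

theorem hankelDet_ne_zero {n : ℕ} {x w : Fin n → ℝ} (hx : Function.Injective x)
    (hw : ∀ j, w j ≠ 0) {s : ℕ → ℝ} (hs : ∀ k < 2 * n, s k = ∑ j, w j * x j ^ k) :
    hankelDet s n ≠ 0 := by
  have h : (Matrix.of fun i j : Fin n => s ((i : ℕ) + (j : ℕ)))
      = (Matrix.vandermonde x).transpose * Matrix.diagonal w * Matrix.vandermonde x := by
    ext i j
    rw [Matrix.of_apply, hs _ (by omega), Matrix.mul_apply]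
    refine Finset.sum_congr rfl fun l _ => ?_
    rw [Matrix.mul_diagonal, Matrix.transpose_apply, Matrix.vandermonde_apply,
      Matrix.vandermonde_apply, pow_add]
    ring
  rw [hankelDet, h, Matrix.det_mul, Matrix.det_mul, Matrix.det_transpose, Matrix.det_diagonal]
  have := Matrix.det_vandermonde_ne_zero_iff.2 hx
  exact mul_ne_zero (mul_ne_zero this (Finset.prod_ne_zero_iff.2 fun j _ => hw j)) this

/-- The bordered matrix is a transposed Vandermonde matrix in the nodes X, x_1, …, x_n times the
constant matrix `B`, so X enters only through the Vandermonde determinant. -/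
theorem borderedHankelDet_eq {n : ℕ} {x w : Fin n → ℝ} (hx : Function.Injective x)
    (hw : ∀ j, w j ≠ 0) {s : ℕ → ℝ} (hs : ∀ k < 2 * n, s k = ∑ j, w j * x j ^ k) :
    ∃ a : ℝ, a ≠ 0 ∧
      borderedHankelDet s n = Polynomial.C a * ∏ j, (Polynomial.X - Polynomial.C (x j)) := by
  have hV := Matrix.det_vandermonde_ne_zero_iff.2 hx
  set B : Matrix (Fin (n + 1)) (Fin (n + 1)) ℝ := Matrix.of fun l j =>
    Fin.cases (if j = Fin.last n then 1 else 0)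
      (fun l => if (j : ℕ) < n then w l * x l ^ (j : ℕ) else 0) l with hB
  have hBdet : B.det ≠ 0 := by
    rw [Matrix.det_succ_row_zero, Finset.sum_eq_single_of_mem (Fin.last n) (Finset.mem_univ _)]
    · have : B.submatrix Fin.succ (Fin.last n).succAbove
          = Matrix.diagonal w * Matrix.vandermonde x := by
        ext l j
        simp [hB, Matrix.diagonal_mul, Matrix.vandermonde_apply]
      rw [this, Matrix.det_mul, Matrix.det_diagonal]
      refine mul_ne_zero (mul_ne_zero (by simp) (by simp [hB]))
        (mul_ne_zero (Finset.prod_ne_zero_iff.2 fun j _ => hw j) hV)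
    · intro j _ hj
      simp [hB, hj]
  set v : Fin (n + 1) → ℝ[X] :=
    Fin.cons (α := fun _ => ℝ[X]) Polynomial.X fun j => Polynomial.C (x j) with hv
  have hfac : (Matrix.of fun i j : Fin (n + 1) =>
      if (j : ℕ) < n then Polynomial.C (s ((i : ℕ) + (j : ℕ))) else Polynomial.X ^ (i : ℕ))
      = (Matrix.vandermonde v).transpose * B.map Polynomial.C := by
    ext1 i j
    rw [Matrix.mul_apply, Fin.sum_univ_succ]
    simp only [Matrix.of_apply, Matrix.transpose_apply, Matrix.vandermonde_apply, Matrix.map_apply,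
      hv, hB, Fin.cons_zero, Fin.cons_succ, Fin.cases_zero, Fin.cases_succ]
    by_cases hj : (j : ℕ) < n
    · have hj' : j ≠ Fin.last n := fun h => by simp [h] at hj
      have := i.2
      rw [hs _ (by omega)]
      simp only [hj, hj', if_true, if_false, map_zero, mul_zero, zero_add, map_sum, map_mul,
        map_pow, pow_add]
      exact Finset.sum_congr rfl fun l _ => by ring
    · have hj' : j = Fin.last n := by ext; simp; omega
      simp [hj']
  have hvdet : (Matrix.vandermonde v).det
      = Polynomial.C ((-1) ^ n * (Matrix.vandermonde x).det)
        * ∏ j, (Polynomial.X - Polynomial.C (x j)) := by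
    rw [Matrix.det_vandermonde, Fin.prod_univ_succ, Fin.prod_Ioi_zero]
    simp only [Fin.prod_Ioi_succ, hv, Fin.cons_zero, Fin.cons_succ]
    have h1 : ∏ j, (Polynomial.C (x j) - Polynomial.X)
        = Polynomial.C ((-1) ^ n) * ∏ j, (Polynomial.X - Polynomial.C (x j)) := by
      have h2 : Polynomial.C ((-1 : ℝ) ^ n) = ∏ _j : Fin n, (-1 : ℝ[X]) := by simp
      rw [h2, ← Finset.prod_mul_distrib]
      exact Finset.prod_congr rfl fun j _ => by ring
    rw [h1, Matrix.det_vandermonde]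
    simp only [map_mul, map_prod, map_sub]
    ring
  refine ⟨(-1) ^ n * (Matrix.vandermonde x).det * B.det,
    mul_ne_zero (mul_ne_zero (by simp) hV) hBdet, ?_⟩
  have hBC : (B.map Polynomial.C).det = Polynomial.C B.det :=
    (RingHom.map_det Polynomial.C B).symm
  rw [borderedHankelDet, hfac, Matrix.det_mul, Matrix.det_transpose, hvdet, hBC]
  simp only [map_mul]
  ring

/-- The nodes of a discrete measure with `n` atoms are the roots of its `n`-th orthogonal
polynomial. -/
theorem roots_monicOrthogonalPoly {n : ℕ} {x w : Fin n → ℝ} (hx : Function.Injective x)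
    (hw : ∀ j, w j ≠ 0) {s : ℕ → ℝ} (hs : ∀ k < 2 * n, s k = ∑ j, w j * x j ^ k) :
    (monicOrthogonalPoly s n).roots = Finset.univ.val.map x := by
  obtain ⟨a, ha, hdet⟩ := borderedHankelDet_eq hx hw hs
  rw [monicOrthogonalPoly, hdet, Polynomial.roots_C_mul _ (inv_ne_zero (hankelDet_ne_zero hx hw hs)),
    Polynomial.roots_C_mul _ ha]
  have := Polynomial.roots_multiset_prod_X_sub_C (Finset.univ.val.map x)
  rwa [Multiset.map_map] at this

theorem momentSeq_momentMap {m : ℕ} (y : Fin (2 * m + 1) → ℝ) {k : ℕ} (hk : k < 2 * (m + 1)) :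
    momentSeq (momentMap y) k = ∑ j, weights y j * nodes y j ^ k := by
  cases k with
  | zero => simp [momentSeq, sum_weights]
  | succ k =>
    have : k < 2 * m + 1 := by omega
    simp [momentSeq, this, momentMap]

/-! ### From vanishing Chebyshev moments to the arcsine law. -/

section Equidistribution

open Filter Polynomial Set

theorem natCast_countP_eq (s : Multiset ℝ) (p : ℝ → Prop) [DecidablePred p] :
    ((s.countP p : ℕ) : ℝ) = (s.map fun y => if p y then (1 : ℝ) else 0).sum := by
  induction s using Multiset.induction with
  | empty => simp
  | cons a s ih =>
    rw [Multiset.countP_cons, Multiset.map_cons, Multiset.sum_cons, ← ih]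
    push_cast
    ring

variable {s : ℕ → Multiset ℝ}

theorem integral_T_cos {k : ℤ} (hk : k ≠ 0) :
    ∫ θ in (0 : ℝ)..Real.pi, (Chebyshev.T ℝ k).eval (Real.cos θ) = 0 := by
  simp only [Chebyshev.T_real_cos]
  have hk' : (k : ℝ) ≠ 0 := by exact_mod_cast hk
  rw [intervalIntegral.integral_comp_mul_left (fun t => Real.cos t) hk', integral_cos]
  simp

theorem tendsto_average_polynomial (hcard : ∀ᶠ n in atTop, Multiset.card (s n) = n)
    (hT : ∀ k : ℕ, k ≠ 0 → Tendsto (fun n : ℕ => (1 / (n : ℝ)) *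
      ((s n).map fun u => (Chebyshev.T ℝ k).eval u).sum) atTop (nhds 0)) (p : ℝ[X]) :
    Tendsto (fun n : ℕ => (1 / (n : ℝ)) * ((s n).map fun u => p.eval u).sum) atTop
      (nhds ((1 / Real.pi) * ∫ θ in (0 : ℝ)..Real.pi, p.eval (Real.cos θ))) := by
  have hint : ∀ p : ℝ[X], IntervalIntegrable (fun θ => p.eval (Real.cos θ)) volume 0 Real.pi :=
    fun p => (by fun_prop : Continuous fun θ => p.eval (Real.cos θ)).intervalIntegrable _ _
  have hlin : ∀ (p q : ℝ[X]) (a b : ℝ),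
      Tendsto (fun n : ℕ => (1 / (n : ℝ)) * ((s n).map fun u => p.eval u).sum) atTop
        (nhds ((1 / Real.pi) * ∫ θ in (0 : ℝ)..Real.pi, p.eval (Real.cos θ))) →
      Tendsto (fun n : ℕ => (1 / (n : ℝ)) * ((s n).map fun u => q.eval u).sum) atTop
        (nhds ((1 / Real.pi) * ∫ θ in (0 : ℝ)..Real.pi, q.eval (Real.cos θ))) →
      Tendsto (fun n : ℕ => (1 / (n : ℝ)) * ((s n).map fun u => (C a * p + C b * q).eval u).sum)
        atTop
        (nhds ((1 / Real.pi) * ∫ θ in (0 : ℝ)..Real.pi, (C a * p + C b * q).eval (Real.cos θ))) := by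
    intro p q a b hp hq
    convert (hp.const_mul a).add (hq.const_mul b) using 2
    · simp only [eval_add, eval_mul, eval_C, Multiset.sum_map_add, Multiset.sum_map_mul_left]
      ring
    · simp only [eval_add, eval_mul, eval_C]
      rw [intervalIntegral.integral_add ((hint p).const_mul a) ((hint q).const_mul b),
        intervalIntegral.integral_const_mul, intervalIntegral.integral_const_mul]
      ring
  have hT' : ∀ k : ℤ, Tendsto (fun n : ℕ => (1 / (n : ℝ)) *
      ((s n).map fun u => (Chebyshev.T ℝ k).eval u).sum) atTop
        (nhds ((1 / Real.pi) * ∫ θ in (0 : ℝ)..Real.pi, (Chebyshev.T ℝ k).eval (Real.cos θ))) := by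
    intro k
    by_cases hk : k = 0
    · subst hk
      have : (1 / Real.pi) * ∫ θ in (0 : ℝ)..Real.pi, (Chebyshev.T ℝ 0).eval (Real.cos θ) = 1 := by
        simp [Real.pi_ne_zero]
      rw [this]
      refine tendsto_const_nhds.congr' ?_
      filter_upwards [hcard, eventually_gt_atTop 0] with n hn hn0
      have : (n : ℝ) ≠ 0 := by positivity
      simp [hn, this]
    · rw [integral_T_cos hk, mul_zero, ← Chebyshev.T_natAbs]
      exact hT k.natAbs (by simpa using hk)
  -- Strengthening the claim to products with all Chebyshev polynomials makes the induction close: X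
  -- T_k is the mean of T_(k+1) and T_(k-1).
  have main : ∀ k : ℤ, Tendsto (fun n : ℕ => (1 / (n : ℝ)) *
      ((s n).map fun u => (p * Chebyshev.T ℝ k).eval u).sum) atTop
        (nhds ((1 / Real.pi) *
          ∫ θ in (0 : ℝ)..Real.pi, (p * Chebyshev.T ℝ k).eval (Real.cos θ))) := by
    induction p using Polynomial.induction_on with
    | C a =>
      intro k
      have := hlin _ _ a 0 (hT' k) (hT' k)
      simpa using this
    | add p q hp hq =>
      intro k
      have := hlin _ _ 1 1 (hp k) (hq k)
      simpa [add_mul] using this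
    | monomial n a h =>
      intro k
      have := hlin _ _ (1 / 2) (1 / 2) (h (k + 1)) (h (k - 1))
      have he : C (1 / 2) * (C a * X ^ n * Chebyshev.T ℝ (k + 1))
          + C (1 / 2) * (C a * X ^ n * Chebyshev.T ℝ (k - 1))
          = C a * X ^ (n + 1) * Chebyshev.T ℝ k := by
        have h2 : (C (1 / 2) * 2 : ℝ[X]) = 1 := by
          rw [show (2 : ℝ[X]) = C 2 from rfl, ← C_mul]; norm_num
        rw [Chebyshev.T_add_one]
        linear_combination (C a * X ^ (n + 1) * Chebyshev.T ℝ k) * h2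
      rwa [he] at this
  simpa using main 0

theorem abs_average_sub_le {n : ℕ} {t : Multiset ℝ} (hcard : Multiset.card t = n)
    {f g : ℝ → ℝ} {ε : ℝ} (hε : 0 ≤ ε) (h : ∀ u ∈ t, |f u - g u| ≤ ε) :
    |(1 / (n : ℝ)) * (t.map f).sum - (1 / (n : ℝ)) * (t.map g).sum| ≤ ε := by
  rw [← mul_sub, ← Multiset.sum_map_sub, abs_mul]
  have h1 : |(t.map fun u => f u - g u).sum| ≤ n * ε := by
    refine (Multiset.abs_sum_le_sum_abs).trans ?_
    rw [Multiset.map_map]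
    have := Multiset.sum_le_card_nsmul (t.map (abs ∘ fun u => f u - g u)) ε (by
      intro x hx
      obtain ⟨u, hu, rfl⟩ := Multiset.mem_map.1 hx
      exact h u hu)
    simpa [hcard] using this
  rcases Nat.eq_zero_or_pos n with hn | hn
  · subst hn; simpa using hε
  · rw [abs_of_pos (by positivity)]
    calc 1 / (n : ℝ) * |(t.map fun u => f u - g u).sum| ≤ 1 / (n : ℝ) * (n * ε) := by gcongr
      _ = ε := by field_simp

theorem tendsto_average_continuous (hcard : ∀ᶠ n in atTop, Multiset.card (s n) = n)
    (hmem : ∀ᶠ n in atTop, ∀ u ∈ s n, u ∈ Icc (-1 : ℝ) 1)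
    (hT : ∀ k : ℕ, k ≠ 0 → Tendsto (fun n : ℕ => (1 / (n : ℝ)) *
      ((s n).map fun u => (Chebyshev.T ℝ k).eval u).sum) atTop (nhds 0))
    {f : ℝ → ℝ} (hf : Continuous f) :
    Tendsto (fun n : ℕ => (1 / (n : ℝ)) * ((s n).map f).sum) atTop
      (nhds ((1 / Real.pi) * ∫ θ in (0 : ℝ)..Real.pi, f (Real.cos θ))) := by
  rw [Metric.tendsto_nhds]
  intro ε hε
  obtain ⟨p, hp⟩ := exists_polynomial_near_of_continuousOn (-1) 1 f hf.continuousOn (ε / 3)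
    (by positivity)
  have hlim := tendsto_average_polynomial hcard hT p
  rw [Metric.tendsto_nhds] at hlim
  have hint : |(1 / Real.pi) * (∫ θ in (0 : ℝ)..Real.pi, p.eval (Real.cos θ))
      - (1 / Real.pi) * ∫ θ in (0 : ℝ)..Real.pi, f (Real.cos θ)| ≤ ε / 3 := by
    rw [← mul_sub, ← intervalIntegral.integral_sub
      ((by fun_prop : Continuous fun θ => p.eval (Real.cos θ)).intervalIntegrable _ _)
      ((by fun_prop : Continuous fun θ => f (Real.cos θ)).intervalIntegrable _ _), abs_mul]
    have := intervalIntegral.norm_integral_le_of_norm_le_const (a := 0) (b := Real.pi) (C := ε / 3)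
      (f := fun θ => p.eval (Real.cos θ) - f (Real.cos θ))
      (fun θ _ => (hp _ ⟨Real.neg_one_le_cos θ, Real.cos_le_one θ⟩).le)
    rw [sub_zero, abs_of_pos Real.pi_pos, Real.norm_eq_abs] at this
    rw [abs_of_pos (by positivity)]
    calc _ ≤ 1 / Real.pi * (ε / 3 * Real.pi) := by gcongr
      _ = ε / 3 := by field_simp
  filter_upwards [hcard, hmem, hlim (ε / 3) (by positivity)] with n h1 h2 h3
  have h4 := abs_average_sub_le h1 (f := f) (g := fun u => p.eval u) (ε := ε / 3) (by positivity)
    fun u hu => by rw [abs_sub_comm]; exact (hp u (h2 u hu)).le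
  rw [Real.dist_eq] at h3 ⊢
  rw [abs_le] at h4 hint
  rw [abs_lt] at h3 ⊢
  constructor <;> linarith [h3.1, h3.2, h4.1, h4.2, hint.1, hint.2]

/-- The continuous function that is `1` before `a`, `0` after `b` and affine in between. -/
def ramp (a b u : ℝ) : ℝ := max 0 (min 1 ((b - u) / (b - a)))

theorem continuous_ramp (a b : ℝ) : Continuous (ramp a b) := by
  unfold ramp; fun_prop

theorem ramp_nonneg (a b u : ℝ) : 0 ≤ ramp a b u := le_max_left _ _

theorem ramp_le_one (a b u : ℝ) : ramp a b u ≤ 1 := max_le zero_le_one (min_le_left _ _)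

theorem ramp_of_le {a b u : ℝ} (hab : a < b) (hu : u ≤ a) : ramp a b u = 1 := by
  have : 1 ≤ (b - u) / (b - a) := by rw [le_div_iff₀ (by linarith)]; linarith
  simp [ramp, this]

theorem ramp_of_ge {a b u : ℝ} (hab : a < b) (hu : b ≤ u) : ramp a b u = 0 := by
  have : (b - u) / (b - a) ≤ 0 := div_nonpos_of_nonpos_of_nonneg (by linarith) (by linarith)
  simp [ramp, this]

theorem intervalIntegrable_ramp (a b c d : ℝ) :
    IntervalIntegrable (fun θ => ramp a b (Real.cos θ)) volume c d :=
  ((continuous_ramp a b).comp Real.continuous_cos).intervalIntegrable _ _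

theorem integral_ramp_le {a b : ℝ} (hab : a < b) :
    ∫ θ in (0 : ℝ)..Real.pi, ramp a b (Real.cos θ) ≤ Real.pi - Real.arccos b := by
  rw [← intervalIntegral.integral_add_adjacent_intervals
    (intervalIntegrable_ramp a b 0 (Real.arccos b)) (intervalIntegrable_ramp a b _ _)]
  have h1 : ∫ θ in (0 : ℝ)..Real.arccos b, ramp a b (Real.cos θ) = 0 := by
    rcases le_total b 1 with hb | hb
    · rw [intervalIntegral.integral_congr (g := fun _ => (0 : ℝ))]
      · simp
      · intro θ hθ
        rw [uIcc_of_le (Real.arccos_nonneg b)] at hθ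
        refine ramp_of_ge hab ?_
        rcases le_total (-1) b with hb' | hb'
        · calc b = Real.cos (Real.arccos b) := (Real.cos_arccos hb' hb).symm
            _ ≤ Real.cos θ := Real.cos_le_cos_of_nonneg_of_le_pi hθ.1 (Real.arccos_le_pi b) hθ.2
        · exact hb'.trans (Real.neg_one_le_cos θ)
    · rw [Real.arccos_eq_zero.2 hb, intervalIntegral.integral_same]
  have h2 : ∫ θ in Real.arccos b..Real.pi, ramp a b (Real.cos θ)
      ≤ ∫ _ in Real.arccos b..Real.pi, (1 : ℝ) :=
    intervalIntegral.integral_mono_on (Real.arccos_le_pi b) (intervalIntegrable_ramp a b _ _)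
      intervalIntegrable_const fun θ _ => ramp_le_one _ _ _
  rw [intervalIntegral.integral_const, smul_eq_mul, mul_one] at h2
  linarith

theorem le_integral_ramp {a b : ℝ} (hab : a < b) :
    Real.pi - Real.arccos a ≤ ∫ θ in (0 : ℝ)..Real.pi, ramp a b (Real.cos θ) := by
  rw [← intervalIntegral.integral_add_adjacent_intervals
    (intervalIntegrable_ramp a b 0 (Real.arccos a)) (intervalIntegrable_ramp a b _ _)]
  have h1 : 0 ≤ ∫ θ in (0 : ℝ)..Real.arccos a, ramp a b (Real.cos θ) :=
    intervalIntegral.integral_nonneg (Real.arccos_nonneg a) fun θ _ => ramp_nonneg _ _ _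
  have h2 : ∫ θ in Real.arccos a..Real.pi, ramp a b (Real.cos θ) = Real.pi - Real.arccos a := by
    rcases le_total (-1) a with ha | ha
    · rw [intervalIntegral.integral_congr (g := fun _ => (1 : ℝ))]
      · simp
      · intro θ hθ
        rw [uIcc_of_le (Real.arccos_le_pi a)] at hθ
        refine ramp_of_le hab ?_
        rcases le_total a 1 with ha' | ha'
        · calc Real.cos θ ≤ Real.cos (Real.arccos a) :=
                Real.cos_le_cos_of_nonneg_of_le_pi (Real.arccos_nonneg a) hθ.2 hθ.1
            _ = a := Real.cos_arccos ha ha'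
        · exact (Real.cos_le_one θ).trans ha'
    · rw [Real.arccos_eq_pi.2 ha, intervalIntegral.integral_same, sub_self]
  linarith

theorem average_mono {n : ℕ} {t : Multiset ℝ} {f g : ℝ → ℝ} (h : ∀ u, f u ≤ g u) :
    (1 / (n : ℝ)) * (t.map f).sum ≤ (1 / (n : ℝ)) * (t.map g).sum := by
  gcongr
  exact Multiset.sum_map_le_sum_map _ _ fun u _ => h u

/-- Points of `[-1,1]` whose Chebyshev moments tend to `0` follow the arcsine law. -/
theorem tendsto_average_indicator (hcard : ∀ᶠ n in atTop, Multiset.card (s n) = n)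
    (hmem : ∀ᶠ n in atTop, ∀ u ∈ s n, u ∈ Icc (-1 : ℝ) 1)
    (hT : ∀ k : ℕ, k ≠ 0 → Tendsto (fun n : ℕ => (1 / (n : ℝ)) *
      ((s n).map fun u => (Chebyshev.T ℝ k).eval u).sum) atTop (nhds 0)) (c : ℝ) :
    Tendsto (fun n : ℕ => (1 / (n : ℝ)) * ((s n).map fun u => if u ≤ c then (1 : ℝ) else 0).sum)
      atTop (nhds (1 / Real.pi * (Real.pi - Real.arccos c))) := by
  have hcont : Continuous fun d => 1 / Real.pi * (Real.pi - Real.arccos d) := by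
    have := Real.continuous_arccos
    fun_prop
  have hL : ∀ a b : ℝ, Tendsto (fun n : ℕ => (1 / (n : ℝ)) * ((s n).map (ramp a b)).sum) atTop _ :=
    fun a b => tendsto_average_continuous hcard hmem hT (continuous_ramp a b)
  refine tendsto_order.2 ⟨fun v hv => ?_, fun v hv => ?_⟩
  · obtain ⟨a, hac, ha⟩ : ∃ a < c, v < 1 / Real.pi * (Real.pi - Real.arccos a) := by
      have h1 := (hcont.tendsto c).mono_left (nhdsWithin_le_nhds (s := Iio c))
      obtain ⟨a, h2, h3⟩ := ((h1.eventually (lt_mem_nhds hv)).and self_mem_nhdsWithin).exists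
      exact ⟨a, h3, h2⟩
    have h4 : v < 1 / Real.pi * ∫ θ in (0 : ℝ)..Real.pi, ramp a c (Real.cos θ) :=
      ha.trans_le (by have := le_integral_ramp hac; gcongr)
    filter_upwards [(hL a c).eventually (lt_mem_nhds h4)] with n hn
    refine hn.trans_le (average_mono fun u => ?_)
    split_ifs with h
    · exact ramp_le_one _ _ _
    · exact (ramp_of_ge hac (not_le.1 h).le).le
  · obtain ⟨b, hcb, hb⟩ : ∃ b > c, 1 / Real.pi * (Real.pi - Real.arccos b) < v := by
      have h1 := (hcont.tendsto c).mono_left (nhdsWithin_le_nhds (s := Ioi c))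
      obtain ⟨a, h2, h3⟩ := ((h1.eventually (gt_mem_nhds hv)).and self_mem_nhdsWithin).exists
      exact ⟨a, h3, h2⟩
    have h4 : 1 / Real.pi * ∫ θ in (0 : ℝ)..Real.pi, ramp c b (Real.cos θ) < v :=
      lt_of_le_of_lt (by have := integral_ramp_le hcb; gcongr) hb
    filter_upwards [(hL c b).eventually (gt_mem_nhds h4)] with n hn
    refine lt_of_le_of_lt (average_mono fun u => ?_) hn
    split_ifs with h
    · exact (ramp_of_le hcb h).ge
    · exact ramp_nonneg _ _ _

end Equidistribution

/-- The arcsine distribution function. -/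
theorem integral_arcsine {x : ℝ} (hx : x ∈ Set.Icc (0 : ℝ) 1) :
    ∫ t in (0 : ℝ)..x, 1 / √(t * (1 - t)) = Real.pi - Real.arccos (2 * x - 1) := by
  have hcont : Continuous fun t : ℝ => -Real.arccos (2 * t - 1) := by
    have := Real.continuous_arccos
    fun_prop
  have hderiv : ∀ t ∈ Set.Ioo 0 x, HasDerivAt (fun t : ℝ => -Real.arccos (2 * t - 1))
      (1 / √(t * (1 - t))) t := by
    intro t ht
    have h1 : t < 1 := ht.2.trans_le hx.2
    have h : HasDerivAt (fun t : ℝ => -Real.arccos (2 * t - 1))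
        (-(-(1 / √(1 - (2 * t - 1) ^ 2)) * (2 * 1))) t := by
      have h0 : HasDerivAt (fun t : ℝ => 2 * t - 1) (2 * 1) t :=
        ((hasDerivAt_id t).const_mul 2).sub_const 1
      exact ((Real.hasDerivAt_arccos (x := 2 * t - 1) (by linarith [ht.1])
        (by linarith)).comp t h0).neg
    have h2 : 1 - (2 * t - 1) ^ 2 = 2 ^ 2 * (t * (1 - t)) := by ring
    have h3 : 0 < √(t * (1 - t)) := Real.sqrt_pos.2 (mul_pos ht.1 (by linarith))
    rw [h2, Real.sqrt_mul (by norm_num), Real.sqrt_sq (by norm_num)] at h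
    refine h.congr_deriv ?_
    field_simp
  rw [intervalIntegral.integral_eq_sub_of_hasDeriv_right_of_le hx.1 hcont.continuousOn
    (fun t ht => (hderiv t ht).hasDerivWithinAt)]
  · norm_num
    ring
  · refine intervalIntegral.intervalIntegrable_deriv_of_nonneg hcont.continuousOn ?_ ?_
    · intro t ht
      rw [min_eq_left hx.1, max_eq_right hx.1] at ht
      exact hderiv t ht
    · intro t _
      positivity

/-! ### Exponential smallness of the bad sets and Borel–Cantelli. -/

/-- The parameters whose `k`-th Chebyshev moment is at least `δ` in absolute value. -/
def badSet (m k : ℕ) (δ : ℝ) : Set (Fin (2 * m + 1) → ℝ) :=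
  paramSpace m ∩ {y | δ * (m + 1 : ℕ) ≤
    |∑ j, (Polynomial.Chebyshev.T ℝ k).eval (2 * nodes y j - 1)|}

theorem measurableSet_badSet (m k : ℕ) (δ : ℝ) : MeasurableSet (badSet m k δ) := by
  refine ((isCompact_paramSpace m).isClosed.inter (isClosed_le continuous_const ?_)).measurableSet
  refine (continuous_finsetSum _ fun j _ => ?_).abs
  have : Continuous fun y : Fin (2 * m + 1) → ℝ => nodes y j :=
    (continuous_apply j).comp continuous_nodes
  fun_prop

/-- At r = 1 the constants cancel, 16 = (1 + 1)^4, leaving an exponential below 1. Continuity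
permits some r < 1, as the energy estimate requires. -/
theorem exists_rate {k : ℕ} (hk : k ≠ 0) {δ : ℝ} (hδ : 0 < δ) :
    ∃ r : ℝ, 0 ≤ r ∧ r < 1 ∧ 16 * ((1 + r) ^ 4)⁻¹ * Real.exp (-(4 * r ^ k / k * δ ^ 2)) < 1 := by
  have hk' : (0 : ℝ) < k := by positivity
  have hc : ContinuousAt (fun r : ℝ =>
      16 * ((1 + r) ^ 4)⁻¹ * Real.exp (-(4 * r ^ k / k * δ ^ 2))) 1 := by
    refine ContinuousAt.mul (continuousAt_const.mul (ContinuousAt.inv₀ (by fun_prop)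
      (by norm_num))) (by fun_prop)
  have h1 : 16 * (((1 : ℝ) + 1) ^ 4)⁻¹ * Real.exp (-(4 * 1 ^ k / k * δ ^ 2)) < 1 := by
    have : Real.exp (-(4 * 1 ^ k / k * δ ^ 2)) < 1 :=
      Real.exp_lt_one_iff.2 (by rw [one_pow]; exact neg_neg_of_pos (by positivity))
    norm_num at this ⊢
    exact this
  have h2 := (hc.tendsto.mono_left (nhdsWithin_le_nhds (s := Set.Iio 1))).eventually
    (gt_mem_nhds h1)
  have h3 : ∀ᶠ r : ℝ in nhdsWithin 1 (Set.Iio 1), 0 < r :=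
    nhdsWithin_le_nhds (lt_mem_nhds zero_lt_one)
  obtain ⟨r, hr, hr0, hr1⟩ := (h2.and (h3.and self_mem_nhdsWithin)).exists
  exact ⟨r, hr0.le, hr1, hr⟩

theorem summable_gaussian_decay {ρ B : ℝ} (hρ0 : 0 ≤ ρ) (hρ1 : ρ < 1) (hB : 0 ≤ B) :
    Summable fun n : ℕ => ρ ^ (n ^ 2) * B ^ n * (2 * n : ℝ) ^ (2 * n) := by
  have hlim : Filter.Tendsto (fun n : ℕ => 4 * B * ((n : ℝ) ^ 2 * ρ ^ n)) Filter.atTop (nhds 0) := by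
    have := (tendsto_pow_const_mul_const_pow_of_abs_lt_one 2 (r := ρ)
      (by rwa [abs_of_nonneg hρ0])).const_mul (4 * B)
    simpa using this
  refine Summable.of_norm_bounded_eventually_nat (g := fun n => (1 / 2 : ℝ) ^ n)
    (summable_geometric_of_lt_one (by norm_num) (by norm_num)) ?_
  filter_upwards [hlim.eventually (gt_mem_nhds (by norm_num : (0 : ℝ) < 1 / 2))] with n hn
  rw [Real.norm_of_nonneg (by positivity)]
  calc ρ ^ (n ^ 2) * B ^ n * (2 * n : ℝ) ^ (2 * n) = (4 * B * ((n : ℝ) ^ 2 * ρ ^ n)) ^ n := by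
        rw [mul_pow, mul_pow, mul_pow, mul_pow, ← pow_mul, ← pow_mul, pow_mul 2 2 n]
        norm_num
        ring
    _ ≤ (1 / 2) ^ n := by gcongr

theorem exists_summable_volume_bad {k : ℕ} (hk : k ≠ 0) {δ : ℝ} (hδ : 0 < δ) :
    ∃ u : ℕ → ℝ, Summable u ∧ ∀ m, volume (momentMap '' badSet m k δ)
      ≤ ENNReal.ofReal (u m) * volume (momentSpace (2 * m + 1)) := by
  obtain ⟨r, hr0, hr1, hr⟩ := exists_rate hk hδ
  set a : ℝ := 4 * r ^ k / k with ha
  have ha0 : 0 ≤ a := by positivity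
  set ρ : ℝ := 16 * ((1 + r) ^ 4)⁻¹ * Real.exp (-(a * δ ^ 2)) with hρ
  set B : ℝ := (1 + r) ^ 4 / (1 - r) ^ 4 with hB
  have hr1' : 0 < 1 - r := by linarith
  have hsum := summable_gaussian_decay (ρ := ρ) (B := B) (by positivity) hr (by positivity)
  refine ⟨_, (summable_nat_add_iff 1).2 hsum, fun m => ?_⟩
  set n := m + 1 with hn
  set N := 2 * m + 1 with hN
  set b : ℝ := (((1 + r) ^ 4)⁻¹) ^ (n ^ 2) * B ^ n * Real.exp (-(a * δ ^ 2)) ^ (n ^ 2) with hb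
  have hupper : volume (momentMap '' badSet m k δ) ≤ ENNReal.ofReal b := by
    refine volume_image_momentMap_le (measurableSet_badSet m k δ) Set.inter_subset_left ?_
    rintro y ⟨hy, hy'⟩
    have h1 := sepProd_sq_le hr0 hr1 (nodes y) hy.1 k
    rw [Fintype.card_fin] at h1
    calc (∏ j, |weights y j|) * sepProd (nodes y) ^ 2 ≤ 1 * sepProd (nodes y) ^ 2 := by
          gcongr; exact prod_abs_weights_le_one hy
      _ ≤ b := by
          rw [one_mul]
          refine h1.trans ?_
          rw [hb, ← Real.exp_nat_mul]
          gcongr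
          have h2 : (δ * (m + 1 : ℕ)) ^ 2
              ≤ (∑ j, (Polynomial.Chebyshev.T ℝ k).eval (2 * nodes y j - 1)) ^ 2 := by
            rw [← sq_abs (∑ j, _)]
            exact pow_le_pow_left₀ (by positivity) hy' 2
          have h3 := mul_le_mul_of_nonneg_left h2 ha0
          rw [hn]
          push_cast at h3 ⊢
          linarith
  refine hupper.trans ?_
  refine le_trans ?_ (mul_le_mul_right (volume_momentSpace_ge_pow N) _)
  rw [← ENNReal.ofReal_mul (by positivity)]
  refine ENNReal.ofReal_le_ofReal ?_
  have hNpos : (0 : ℝ) < N := by positivity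
  -- Here N = 2n - 1, so N (N + 1) ≤ 4 n^2: the base 16 matches the one in `exists_rate`.
  have hpow : (1 / 16 : ℝ) ^ (n ^ 2) ≤ (1 / 2) ^ (N * (N + 1)) := by
    rw [show (1 / 16 : ℝ) = (1 / 2) ^ 4 by norm_num, ← pow_mul]
    exact pow_le_pow_of_le_one (by norm_num) (by norm_num) (by rw [hN, hn]; nlinarith)
  have hNN : (1 : ℝ) ≤ (2 * (n : ℝ)) ^ (2 * n) * (1 / (N : ℝ)) ^ N := by
    rw [one_div, inv_pow, ← div_eq_mul_inv, le_div_iff₀ (by positivity), one_mul]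
    have h1 : (N : ℝ) ≤ 2 * n := by rw [hN, hn]; push_cast; linarith
    have h2 : (1 : ℝ) ≤ 2 * n := by rw [hn]; push_cast; nlinarith [(Nat.cast_nonneg m : (0 : ℝ) ≤ m)]
    calc (N : ℝ) ^ N ≤ (2 * (n : ℝ)) ^ N := by gcongr
      _ ≤ (2 * (n : ℝ)) ^ (2 * n) := pow_le_pow_right₀ h2 (by omega)
  have hbρ : b = ρ ^ (n ^ 2) * B ^ n * (1 / 16) ^ (n ^ 2) := by
    have h16 : (16 : ℝ) ^ (n ^ 2) * (1 / 16) ^ (n ^ 2) = 1 := by rw [← mul_pow]; norm_num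
    rw [hb, hρ, mul_pow, mul_pow]
    linear_combination -(((1 + r) ^ 4)⁻¹ ^ (n ^ 2) * B ^ n
      * Real.exp (-(a * δ ^ 2)) ^ (n ^ 2)) * h16
  have hρ0 : 0 ≤ ρ := by positivity
  have hB0 : 0 ≤ B := by positivity
  calc b = ρ ^ (n ^ 2) * B ^ n * ((1 / 16) ^ (n ^ 2) * 1) := by rw [hbρ, mul_one]
    _ ≤ ρ ^ (n ^ 2) * B ^ n * ((1 / 2) ^ (N * (N + 1)) *
        ((2 * (n : ℝ)) ^ (2 * n) * (1 / (N : ℝ)) ^ N)) := by gcongr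
    _ = _ := by ring

theorem measure_preimage_le_of_isUniform {Ω : Type*} [MeasurableSpace Ω] {P : Measure Ω}
    {N : ℕ} {X : Ω → Fin N → ℝ} (hX : AEMeasurable X P)
    (hU : pdf.IsUniform X (momentSpace N) P volume) {B : Set (Fin N → ℝ)} {u : ENNReal}
    (hB : volume B ≤ u * volume (momentSpace N)) : P (X ⁻¹' B) ≤ u := by
  refine (Measure.le_map_apply hX B).trans ?_
  rw [hU, ProbabilityTheory.cond, Measure.smul_apply, smul_eq_mul]
  calc (volume (momentSpace N))⁻¹ * volume.restrict (momentSpace N) B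
      ≤ (volume (momentSpace N))⁻¹ * (u * volume (momentSpace N)) := by
        gcongr
        exact (Measure.restrict_le_self B).trans hB
    _ = u * ((volume (momentSpace N))⁻¹ * volume (momentSpace N)) := by ring
    _ ≤ u * 1 := by gcongr; exact ENNReal.inv_mul_le_one _
    _ = u := mul_one u

theorem ae_mem_of_isUniform {Ω : Type*} [MeasurableSpace Ω] {P : Measure Ω} {m : ℕ}
    {X : Ω → Fin (2 * m + 1) → ℝ} (hX : AEMeasurable X P)
    (hU : pdf.IsUniform X (momentSpace (2 * m + 1)) P volume) :
    ∀ᵐ ω ∂P, X ω ∈ momentSpace (2 * m + 1) := by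
  have hmeas : MeasurableSet (momentSpace (2 * m + 1)) := by
    rw [momentSpace_eq_image]
    exact ((isCompact_paramSpace m).image continuous_momentMap).measurableSet
  refine le_antisymm ((Measure.le_map_apply hX (momentSpace (2 * m + 1))ᶜ).trans ?_) (zero_le)
  rw [hU, ProbabilityTheory.cond, Measure.smul_apply, Measure.restrict_apply hmeas.compl]
  simp

/-- Almost every moment vector comes from a discrete measure with distinct atoms and positive
weights. -/
theorem ae_exists_param_of_isUniform {Ω : Type*} [MeasurableSpace Ω] {P : Measure Ω} {m : ℕ}
    {X : Ω → Fin (2 * m + 1) → ℝ} (hX : AEMeasurable X P)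
    (hU : pdf.IsUniform X (momentSpace (2 * m + 1)) P volume) :
    ∀ᵐ ω ∂P, ∃ y ∈ paramSpace m, momentMap y = X ω ∧ Function.Injective (nodes y) ∧
      ∀ j, weights y j ≠ 0 := by
  set S : Set (Fin (2 * m + 1) → ℝ) :=
    paramSpace m ∩ {y | (∏ j, |weights y j|) * sepProd (nodes y) ^ 2 = 0} with hS
  have hSmeas : MeasurableSet S := by
    refine ((isCompact_paramSpace m).isClosed.inter
      (isClosed_eq (Continuous.mul ?_ ?_) continuous_const)).measurableSet
    · exact continuous_finsetProd _ fun j _ => ((continuous_apply j).comp continuous_weights).abs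
    · exact (continuous_sepProd.comp continuous_nodes).pow 2
  -- As in Sard's theorem, the image of the set where the Jacobian vanishes is null.
  have hvol : volume (momentMap '' S) ≤ 0 * volume (momentSpace (2 * m + 1)) := by
    rw [zero_mul, ← ENNReal.ofReal_zero]
    exact volume_image_momentMap_le hSmeas Set.inter_subset_left fun y hy => hy.2.le
  have hnull : ∀ᵐ ω ∂P, X ω ∉ momentMap '' S := by
    have h0 := measure_preimage_le_of_isUniform hX hU hvol
    exact measure_eq_zero_iff_ae_notMem.1 (le_antisymm h0 zero_le)
  filter_upwards [hnull, ae_mem_of_isUniform hX hU] with ω h1 h2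
  rw [momentSpace_eq_image] at h2
  obtain ⟨y, hy, hyX⟩ := h2
  have hne : (∏ j, |weights y j|) * sepProd (nodes y) ^ 2 ≠ 0 := fun h =>
    h1 ⟨y, ⟨hy, h⟩, hyX⟩
  refine ⟨y, hy, hyX, ?_, fun j hj => hne ?_⟩
  · by_contra hinj
    exact hne (by rw [sepProd_eq_zero hinj]; simp)
  · rw [Finset.prod_eq_zero (Finset.mem_univ j) (by simp [hj]), zero_mul]

theorem ae_eventually_notMem_bad {Ω : Type*} [MeasurableSpace Ω] {P : Measure Ω}
    {X : (m : ℕ) → Ω → Fin (2 * m + 1) → ℝ} (hX : ∀ m, AEMeasurable (X m) P)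
    (hU : ∀ m, pdf.IsUniform (X m) (momentSpace (2 * m + 1)) P volume) {k : ℕ} (hk : k ≠ 0)
    {δ : ℝ} (hδ : 0 < δ) :
    ∀ᵐ ω ∂P, ∀ᶠ m in Filter.atTop, X m ω ∉ momentMap '' badSet m k δ := by
  obtain ⟨u, hu, hvol⟩ := exists_summable_volume_bad hk hδ
  refine ae_eventually_notMem (s := fun m => X m ⁻¹' (momentMap '' badSet m k δ)) ?_
  refine ne_top_of_le_ne_top hu.tsum_ofReal_ne_top (ENNReal.tsum_le_tsum fun m => ?_)
  exact measure_preimage_le_of_isUniform (hX m) (hU m) (hvol m)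

end

/-! ### Assembly of the almost sure statement. -/

theorem theorem3p2 {Ω : Type*} [MeasurableSpace Ω] (P : Measure Ω) [IsProbabilityMeasure P]
    (C : (n : ℕ) → Ω → (Fin (2 * n - 1) → ℝ))
    (hC : ∀ n : ℕ, 1 ≤ n →
      AEMeasurable (C n) P ∧ pdf.IsUniform (C n) (momentSpace (2 * n - 1)) P volume) :
    ∀ᵐ ω ∂P,
      (∀ n : ℕ, 1 ≤ n →
        Multiset.card (monicOrthogonalPoly (momentSeq (C n ω)) n).roots = n) ∧
      ∀ x ∈ Set.Icc (0 : ℝ) 1,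
        Filter.Tendsto
          (fun n : ℕ => rootEDF n (monicOrthogonalPoly (momentSeq (C n ω)) n) x)
          Filter.atTop
          (nhds ((1 / Real.pi) * ∫ t in (0 : ℝ)..x, 1 / Real.sqrt (t * (1 - t)))) := by
  -- The shift n = m + 1 removes the truncated subtraction in `2 * n - 1`.
  let X : (m : ℕ) → Ω → Fin (2 * m + 1) → ℝ := fun m => C (m + 1)
  have hX : ∀ m, AEMeasurable (X m) P := fun m => (hC (m + 1) (by omega)).1
  have hU : ∀ m, pdf.IsUniform (X m) (momentSpace (2 * m + 1)) P volume := fun m =>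
    (hC (m + 1) (by omega)).2
  have hparam := ae_all_iff.2 fun m => ae_exists_param_of_isUniform (hX m) (hU m)
  -- Thresholds 1/(q + 1) suffice and keep the intersection of almost sure events countable.
  have hbad : ∀ᵐ ω ∂P, ∀ k : ℕ, ∀ q : ℕ, k ≠ 0 →
      ∀ᶠ m in Filter.atTop, X m ω ∉ momentMap '' badSet m k (1 / ((q : ℝ) + 1)) := by
    refine ae_all_iff.2 fun k => ae_all_iff.2 fun q => ?_
    by_cases hk : k = 0
    · simp [hk]
    · filter_upwards [ae_eventually_notMem_bad hX hU hk (δ := 1 / ((q : ℝ) + 1)) (by positivity)]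
        with ω hω _ using hω
  filter_upwards [hparam, hbad] with ω h1 h2
  choose y hy hyX hinj hw using h1
  have hroots : ∀ m, (monicOrthogonalPoly (momentSeq (C (m + 1) ω)) (m + 1)).roots
      = Finset.univ.val.map (nodes (y m)) := fun m => by
    have : C (m + 1) ω = momentMap (y m) := (hyX m).symm
    rw [this]
    exact roots_monicOrthogonalPoly (hinj m) (hw m) fun k hk => momentSeq_momentMap (y m) hk
  have hcard : ∀ n : ℕ, 1 ≤ n →
      Multiset.card (monicOrthogonalPoly (momentSeq (C n ω)) n).roots = n := by
    intro n hn
    obtain ⟨m, rfl⟩ := Nat.exists_eq_add_of_le' hn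
    rw [hroots]
    simp
  refine ⟨hcard, fun x hx => ?_⟩
  set s : ℕ → Multiset ℝ := fun n =>
    (monicOrthogonalPoly (momentSeq (C n ω)) n).roots.map fun t => 2 * t - 1 with hs
  have hscard : ∀ᶠ n in Filter.atTop, Multiset.card (s n) = n := by
    filter_upwards [Filter.eventually_ge_atTop 1] with n hn
    rw [hs, Multiset.card_map, hcard n hn]
  have hsmem : ∀ᶠ n in Filter.atTop, ∀ u ∈ s n, u ∈ Set.Icc (-1 : ℝ) 1 := by
    filter_upwards [Filter.eventually_ge_atTop 1] with n hn u hu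
    obtain ⟨m, rfl⟩ := Nat.exists_eq_add_of_le' hn
    obtain ⟨t, ht, rfl⟩ := Multiset.mem_map.1 hu
    rw [hroots] at ht
    obtain ⟨j, -, rfl⟩ := Multiset.mem_map.1 ht
    have := (hy m).1 j
    exact ⟨by linarith [this.1], by linarith [this.2]⟩
  have hT : ∀ k : ℕ, k ≠ 0 → Filter.Tendsto (fun n : ℕ => (1 / (n : ℝ)) *
      ((s n).map fun u => (Polynomial.Chebyshev.T ℝ k).eval u).sum) Filter.atTop (nhds 0) := by
    intro k hk
    refine (Filter.tendsto_add_atTop_iff_nat 1).1 ?_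
    rw [Metric.tendsto_nhds]
    intro ε hε
    obtain ⟨q, hq⟩ := exists_nat_one_div_lt hε
    filter_upwards [h2 k q hk] with m hm
    have hlt : |∑ j, (Polynomial.Chebyshev.T ℝ k).eval (2 * nodes (y m) j - 1)|
        < 1 / ((q : ℝ) + 1) * (m + 1 : ℕ) := by
      by_contra! hge
      exact hm ⟨y m, ⟨hy m, hge⟩, hyX m⟩
    have hsum : ((s (m + 1)).map fun u => (Polynomial.Chebyshev.T ℝ k).eval u).sum
        = ∑ j, (Polynomial.Chebyshev.T ℝ k).eval (2 * nodes (y m) j - 1) := by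
      rw [hs]
      simp only [hroots, Multiset.map_map]
      rfl
    have hm0 : (0 : ℝ) < (m + 1 : ℕ) := by positivity
    rw [hsum, Real.dist_eq, sub_zero, abs_mul, abs_of_pos (by positivity), one_div_mul_eq_div,
      div_lt_iff₀ hm0]
    exact hlt.trans (by gcongr)
  have hlim := tendsto_average_indicator hscard hsmem hT (2 * x - 1)
  rw [integral_arcsine hx]
  refine hlim.congr fun n => ?_
  rw [rootEDF, natCast_countP_eq, hs, Multiset.map_map]
  congr 3
  ext t
  simp
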